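/- For real $x\in[0,1]$ put $\alpha_0(x)=x$ and $\alpha_{k+1}(x)=\{1/\alpha_k(x)\}$ (fractional part) as long as $\alpha_k(x)\neq 0$. For irrational $x\in(0,1)$ all the $\alpha_k(x)$ are defined and lie in $(0,1)$, and the Brjuno function is $$\Phi(x)=\sum_{k\ge 0}\alpha_0(x)\alpha_1(x)\cdots\alpha_{k-1}(x)\,\log\frac1{\alpha_k(x)}\in(0,\infty].$$ For rational $x\in[0,1]$ let $\Phi(x)$ be the finite sum of the same terms over $0\le k<K$, where $K$ is the first index with $\alpha_K(x)=0$. A Brjuno number is an irrational $x\in(0,1)$ for which the series $\Phi(x)$ converges. A point $x\in(0,1)$ is a Lebesgue point of $\Phi$ if $$\frac1h\int_{x-h/2}^{x+h/2}|\Phi(t)-\Phi(x)|\,dt\longrightarrow 0\qquad(h\to0^+),$$ with the convention $|\Phi(t)-\infty|=\infty$. **Theorem.** The set of Lebesgue points of $\Phi$ in $(0,1)$ is exactly the set of Brjuno numbers. Moreover the values given to $\Phi$ at the other points play no role: the set of those $x\in(0,1)$ for which there is a real number $c$ with $$\frac1h\int_{x-h/2}^{x+h/2}|\Phi(t)-c|\,dt\longrightarrow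 0\qquad(h\to0^+)$$ is also exactly the set of Brjuno numbers. -/

import Mathlib

namespace Brjuno

open Filter Topology MeasureTheory

noncomputable section

/-- The Gauss map `x ↦ {1/x}` (with the value `0` at `x = 0`). -/
def gaussMap (x : ℝ) : ℝ := Int.fract (1 / x)

/-- The iterates `α_k` of the Gauss map, with `α_0 x = x`. -/
def alpha (k : ℕ) (x : ℝ) : ℝ := gaussMap^[k] x

/-- The `k`-th term `α_0(x) ⋯ α_{k-1}(x) log (1 / α_k(x))` of the Brjuno series.
If `x` is a rational number in `[0,1]` and `K` is the first index with `α_K(x) = 0`, then the terms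
of index at least `K` vanish (the logarithm is `0` for index `K`, the product is `0` afterwards), so
that the series is the finite sum over `k < K`. -/
def term (k : ℕ) (x : ℝ) : ℝ :=
  (∏ j ∈ Finset.range k, alpha j x) * Real.log (1 / alpha k x)

lemma alpha_mem_Icc {x : ℝ} (hx : x ∈ Set.Icc (0 : ℝ) 1) (k : ℕ) :
    alpha k x ∈ Set.Icc (0 : ℝ) 1 := by
  cases k with
  | zero => simpa [alpha] using hx
  | succ k =>
    rw [alpha, Function.iterate_succ_apply']
    exact ⟨Int.fract_nonneg _, (Int.fract_lt_one _).le⟩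

/-- On `[0,1]` all terms are nonnegative. -/
lemma term_nonneg {x : ℝ} (hx : x ∈ Set.Icc (0 : ℝ) 1) (k : ℕ) : 0 ≤ term k x := by
  refine mul_nonneg (Finset.prod_nonneg fun j _ => (alpha_mem_Icc hx j).1) ?_
  have h := alpha_mem_Icc hx k
  rw [one_div, Real.log_inv]
  linarith [Real.log_nonpos h.1 h.2]

/-- The Brjuno function `Φ(x) = ∑_k α_0(x) ⋯ α_{k-1}(x) log (1 / α_k(x))`, with values in `[0,∞]`;
only its values on `[0,1]`, where all terms are nonnegative, are meaningful. -/
def Phi (x : ℝ) : EReal := ((∑' k, ENNReal.ofReal (term k x) : ENNReal) : EReal)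

/-- The Brjuno numbers: the irrational `x` in `(0,1)` for which the Brjuno series converges. -/
def brjunoNumbers : Set ℝ :=
  {x | x ∈ Set.Ioo (0 : ℝ) 1 ∧ Irrational x ∧ Summable fun k => term k x}

/-- `(1/h) ∫_{x-h/2}^{x+h/2} |f(t) - c| dt` for `h > 0`, as an element of `[0,∞]`.
Here `EReal.abs` takes values in `[0,∞]`, and `|f(t) - c| = ∞` if `c` is infinite. -/
def meanDeviation (f : ℝ → EReal) (c : EReal) (x h : ℝ) : ENNReal :=
  (∫⁻ t in Set.Icc (x - h / 2) (x + h / 2), (f t - c).abs) / ENNReal.ofReal h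

/-- `x`, a point of an open interval on which `f` is defined and measurable, is a Lebesgue point
of `f`: `(1/h) ∫_{x-h/2}^{x+h/2} |f(t) - f(x)| dt → 0` as `h → 0`. -/
def IsLebesguePoint (f : ℝ → EReal) (x : ℝ) : Prop :=
  Tendsto (meanDeviation f (f x) x) (𝓝[>] 0) (𝓝 0)

/-- `x` is an `L¹`-Lebesgue point of `f`: the same with some real number `c` in place of `f x`. -/
def IsLOneLebesguePoint (f : ℝ → EReal) (x : ℝ) : Prop :=
  ∃ c : ℝ, Tendsto (meanDeviation f (c : EReal) x) (𝓝[>] 0) (𝓝 0)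

end

end Brjuno

namespace Brjuno

open Filter Topology MeasureTheory

noncomputable section

/-! Everything rests on the functional equation `phi x = log (1/x) + x * phi (gaussMap x)`
(`phi_eq`).

Away from the Brjuno numbers, `phi` tends to infinity on punctured neighbourhoods, so no finite
constant can be a limit in mean. At an irrational `x` with `phi x = ⊤` this is lower semicontinuity,
since each term is continuous at irrationals. At a rational it follows by descent on the
denominator: near an integer the logarithm blows up, and the functional equation carries this back
along the Gauss map (`tendsto_phi_fract_rat`).

At a Brjuno number `x` with value `c`, lower semicontinuity gives `phi ≥ c - ε` nearby, so that
`|phi - c| ≤ phi - c + 2ε`. It remains to see that the means of `phi` over small intervals around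
`x` are at most `c + ε` (`localMeanLE_of_summable`). A maximal inequality (`lintegral_phi_le`)
bounds the mean over any interval containing an irrational `y` by a constant times `phi y + 2 + y`.
It is applied at `y = alpha n x` and pulled back through `n` steps of the functional equation, which
costs the `n`-th partial sum and multiplies the bound by `β n = α_0 ⋯ α_{n-1}`. Now `β n * phi
(alpha n x)` is the tail of the series and `β n → 0`, so the constant in the maximal inequality
disappears in the limit.

The maximal inequality is proved by following an interval along the Gauss map until it contains an
integer reciprocal or is long compared with its distance from `0`. Weights `(a + b * u)⁻³` keep the
constants from growing along the way. -/

/-! ### Functional equation, irrational orbits and measurability. -/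

/-- The Brjuno function with values in `[0,∞]`. -/
def phi (x : ℝ) : ENNReal := ∑' k, ENNReal.ofReal (term k x)

lemma Phi_eq (x : ℝ) : Phi x = ((phi x : ENNReal) : EReal) := rfl

lemma alpha_zero (x : ℝ) : alpha 0 x = x := rfl

lemma alpha_succ (k : ℕ) (x : ℝ) : alpha (k + 1) x = alpha k (gaussMap x) :=
  Function.iterate_succ_apply _ _ _

lemma alpha_succ' (k : ℕ) (x : ℝ) : alpha (k + 1) x = gaussMap (alpha k x) :=
  Function.iterate_succ_apply' _ _ _

lemma prod_alpha_succ (k : ℕ) (x : ℝ) :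
    ∏ j ∈ Finset.range (k + 1), alpha j x = x * ∏ j ∈ Finset.range k, alpha j (gaussMap x) := by
  rw [Finset.prod_range_succ', mul_comm]
  simp [alpha_zero, alpha_succ]

lemma term_zero (x : ℝ) : term 0 x = Real.log (1 / x) := by
  simp [term, alpha_zero]

lemma term_succ (k : ℕ) (x : ℝ) : term (k + 1) x = x * term k (gaussMap x) := by
  rw [term, prod_alpha_succ, alpha_succ, term, mul_assoc]

lemma phi_eq {x : ℝ} (hx : 0 ≤ x) :
    phi x = ENNReal.ofReal (Real.log (1 / x)) + ENNReal.ofReal x * phi (gaussMap x) := by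
  rw [phi, tsum_eq_zero_add' ENNReal.summable, term_zero, phi, ← ENNReal.tsum_mul_left]
  simp only [term_succ, ENNReal.ofReal_mul hx]

lemma gaussMap_inv (v : ℝ) : gaussMap v⁻¹ = Int.fract v := by
  simp [gaussMap]

lemma gaussMap_nonneg (x : ℝ) : 0 ≤ gaussMap x := Int.fract_nonneg _

lemma gaussMap_lt_one (x : ℝ) : gaussMap x < 1 := Int.fract_lt_one _

lemma irrational_gaussMap {x : ℝ} (hx : Irrational x) : Irrational (gaussMap x) := by
  rw [gaussMap, Int.fract, one_div]
  exact hx.inv.sub_intCast _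

lemma irrational_alpha {x : ℝ} (hx : Irrational x) (k : ℕ) : Irrational (alpha k x) := by
  induction k generalizing x with
  | zero => exact hx
  | succ k ih => rw [alpha_succ]; exact ih (irrational_gaussMap hx)

lemma gaussMap_mem_Ioo {x : ℝ} (hx : Irrational x) : gaussMap x ∈ Set.Ioo (0 : ℝ) 1 :=
  ⟨(gaussMap_nonneg x).lt_of_ne (irrational_gaussMap hx).ne_zero.symm, gaussMap_lt_one x⟩

lemma alpha_mem_Ioo {x : ℝ} (hx : Irrational x) (h : x ∈ Set.Ioo (0 : ℝ) 1) (k : ℕ) :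
    alpha k x ∈ Set.Ioo (0 : ℝ) 1 := by
  cases k with
  | zero => exact h
  | succ k => rw [alpha_succ']; exact gaussMap_mem_Ioo (irrational_alpha hx k)

lemma measurable_gaussMap : Measurable gaussMap :=
  measurable_fract.comp (measurable_const.div measurable_id)

lemma measurable_alpha (k : ℕ) : Measurable (alpha k) := measurable_gaussMap.iterate k

lemma measurable_term (k : ℕ) : Measurable (term k) :=
  (Finset.measurable_fun_prod _ fun j _ => measurable_alpha j).mul
    (Real.measurable_log.comp (measurable_const.div (measurable_alpha k)))

lemma measurable_phi : Measurable phi :=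
  Measurable.tsum fun k => (measurable_term k).ennreal_ofReal

/-! ### The transfer operator of the Gauss map and integrability of `phi`. -/

/-- Change of variables `t = 1 / (c + u)`. -/
lemma lintegral_image_inv_add (c : ℝ) {S : Set ℝ} (hS : MeasurableSet S)
    (hpos : ∀ u ∈ S, 0 < c + u) (g : ℝ → ENNReal) :
    ∫⁻ t in (fun u => (c + u)⁻¹) '' S, g t =
      ∫⁻ u in S, ENNReal.ofReal (((c + u) ^ 2)⁻¹) * g (c + u)⁻¹ := by
  rw [lintegral_image_eq_lintegral_abs_deriv_mul hS
    (f' := fun u => -1 / (c + u) ^ 2)]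
  · refine setLIntegral_congr_fun hS fun u hu => ?_
    have := hpos u hu
    simp only [neg_div, abs_neg, one_div]
    rw [abs_of_pos (by positivity)]
  · intro u hu
    have h1 : HasDerivAt (fun u => c + u) 1 u := by
      simpa using (hasDerivAt_id u).const_add c
    exact (h1.inv (hpos u hu).ne').hasDerivWithinAt
  · intro u _ v _ h
    simpa using h

lemma image_inv_add_Icc (c : ℝ) {s t : ℝ} (hs : 0 < s) (hst : s ≤ t) :
    (fun u => (c + u)⁻¹) '' Set.Icc (t⁻¹ - c) (s⁻¹ - c) = Set.Icc s t := by
  have ht := hs.trans_le hst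
  ext y
  constructor
  · rintro ⟨u, ⟨h1, h2⟩, rfl⟩
    have h3 : 0 < t⁻¹ := inv_pos.2 ht
    constructor
    · rw [le_inv_comm₀ hs (by linarith)]; linarith
    · rw [inv_le_comm₀ (by linarith) ht]; linarith
  · rintro ⟨h1, h2⟩
    have hy := hs.trans_le h1
    refine ⟨y⁻¹ - c, ⟨?_, ?_⟩, by simp⟩
    · have := inv_anti₀ hy h2; linarith
    · have := inv_anti₀ hs h1; linarith

lemma lintegral_Icc_inv (c : ℝ) {s t : ℝ} (hs : 0 < s) (hst : s ≤ t) (g : ℝ → ENNReal) :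
    ∫⁻ y in Set.Icc s t, g y =
      ∫⁻ u in Set.Icc (t⁻¹ - c) (s⁻¹ - c), ENNReal.ofReal (((c + u) ^ 2)⁻¹) * g (c + u)⁻¹ := by
  rw [← image_inv_add_Icc c hs hst, lintegral_image_inv_add c measurableSet_Icc]
  intro u hu
  have h3 : 0 < t⁻¹ := inv_pos.2 (hs.trans_le hst)
  linarith [hu.1]

lemma lintegral_log_one_div {L : ℝ} (hL : 0 < L) (hL1 : L ≤ 1) :
    ∫⁻ t in Set.Icc 0 L, ENNReal.ofReal (Real.log (1 / t)) =
      ENNReal.ofReal (L * (1 + Real.log (1 / L))) := by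
  have hint : IntervalIntegrable (fun t : ℝ => Real.log (1 / t)) volume 0 L := by
    simp only [one_div, Real.log_inv]
    exact intervalIntegral.intervalIntegrable_log'.neg
  rw [setLIntegral_congr Ioc_ae_eq_Icc.symm, ← ofReal_integral_eq_lintegral_ofReal,
    ← intervalIntegral.integral_of_le hL.le]
  · simp only [one_div, Real.log_inv]
    rw [intervalIntegral.integral_neg, integral_log]
    congr 1
    simp
    ring
  · exact (intervalIntegrable_iff_integrableOn_Ioc_of_le hL.le).1 hint
  · refine (ae_restrict_iff' measurableSet_Ioc).2 (ae_of_all _ fun t ht => ?_)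
    simp only [one_div, Real.log_inv, Pi.zero_apply]
    linarith [Real.log_nonpos ht.1.le (ht.2.trans hL1)]

/-- A bound for the transfer operator of the Gauss map, from a telescoping majorant `D`. -/
lemma lintegral_mul_gaussMap_le {g k : ℝ → ENNReal} (hg : Measurable g) {D : ℝ → ℝ}
    (hD : Measurable D) (hD0 : ∀ v, 1 ≤ v → 0 ≤ D v) (hDa : ∀ v, 1 ≤ v → D (v + 1) ≤ D v)
    (hk : ∀ v, 1 ≤ v → ENNReal.ofReal ((v ^ 2)⁻¹) * k v⁻¹ ≤ ENNReal.ofReal (D v - D (v + 1))) :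
    ∫⁻ t in Set.Icc 0 1, k t * g (gaussMap t) ≤
      ∫⁻ u in Set.Icc 0 1, ENNReal.ofReal (D (1 + u)) * g u := by
  have hcover : Set.Ioc (0 : ℝ) 1 ⊆
      ⋃ m : ℕ, (fun u : ℝ => ((m + 1 : ℝ) + u)⁻¹) '' Set.Ico 0 1 := by
    intro t ht
    have h1 : 1 ≤ t⁻¹ := (one_le_inv₀ ht.1).2 ht.2
    obtain ⟨m, hm⟩ := Nat.exists_eq_add_of_le' ((Nat.one_le_floor_iff _).2 h1)
    refine Set.mem_iUnion.2 ⟨m, t⁻¹ - (m + 1), ⟨?_, ?_⟩, by simp⟩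
    · have := Nat.floor_le (zero_le_one.trans h1)
      rw [hm] at this; push_cast at this; linarith
    · have := Nat.lt_floor_add_one t⁻¹
      rw [hm] at this; push_cast at this; linarith
  rw [setLIntegral_congr Ioc_ae_eq_Icc.symm, setLIntegral_congr Ico_ae_eq_Icc.symm]
  refine (lintegral_mono_set hcover).trans ((lintegral_iUnion_le _ _).trans ?_)
  -- On branch `m` the Gauss map inverts `u ↦ (m + 1 + u)⁻¹`. By `hk` the Jacobian times `k` is at
  -- most a difference of consecutive values of `D`, so the sum over the branches telescopes to at
  -- most `D (1 + u)`.
  have hpiece : ∀ m : ℕ,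
      ∫⁻ t in (fun u : ℝ => ((m + 1 : ℝ) + u)⁻¹) '' Set.Ico 0 1, k t * g (gaussMap t) ≤
      ∫⁻ u in Set.Ico 0 1, ENNReal.ofReal (D (m + 1 + u) - D (m + 1 + u + 1)) * g u := by
    intro m
    rw [lintegral_image_inv_add _ measurableSet_Ico]
    · refine setLIntegral_mono' measurableSet_Ico fun u hu => ?_
      have : Int.fract ((m + 1 : ℝ) + u) = u := by
        have : ((m + 1 : ℝ) + u) = ((m + 1 : ℕ) : ℝ) + u := by push_cast; ring
        rw [this, Int.fract_natCast_add, Int.fract_eq_self.2 hu]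
      rw [gaussMap_inv, this, ← mul_assoc]
      have h0 := m.cast_nonneg (α := ℝ)
      exact mul_le_mul_left (hk _ (by linarith [hu.1])) _
    · intro u hu
      have h0 := m.cast_nonneg (α := ℝ)
      linarith [hu.1]
  refine (ENNReal.tsum_le_tsum hpiece).trans ?_
  rw [← lintegral_tsum]
  · refine setLIntegral_mono' measurableSet_Ico fun u hu => ?_
    rw [ENNReal.tsum_mul_right]
    refine mul_le_mul_left (ENNReal.tsum_le_of_sum_range_le fun n => ?_) _
    rw [← ENNReal.ofReal_sum_of_nonneg]
    · have : ∑ i ∈ Finset.range n, (D (i + 1 + u) - D (i + 1 + u + 1)) =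
          D (1 + u) - D (n + 1 + u) := by
        induction n with
        | zero => simp
        | succ n ih =>
          rw [Finset.sum_range_succ, ih]; push_cast
          rw [show (n : ℝ) + 1 + u + 1 = n + 1 + 1 + u by ring]; ring
      rw [this]
      refine ENNReal.ofReal_le_ofReal ?_
      have h0 := n.cast_nonneg (α := ℝ)
      linarith [hD0 (n + 1 + u) (by linarith [hu.1])]
    · intro i _
      have h0 := i.cast_nonneg (α := ℝ)
      linarith [hDa (i + 1 + u) (by linarith [hu.1])]
  · intro m
    exact ((((hD.comp (measurable_const.add measurable_id)).sub
      (hD.comp ((measurable_const.add measurable_id).add measurable_const))).ennreal_ofReal).mul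
      hg).aemeasurable

lemma lintegral_gaussMap_le {g : ℝ → ENNReal} (hg : Measurable g) :
    ∫⁻ t in Set.Icc 0 1, g (gaussMap t) ≤ 2 * ∫⁻ u in Set.Icc 0 1, g u := by
  have h := lintegral_mul_gaussMap_le (k := fun _ => 1) hg (D := fun v => 2 / v)
    (by fun_prop) (fun v hv => by positivity)
    (fun v hv => by gcongr; linarith) (fun v hv => by
      rw [mul_one]
      refine ENNReal.ofReal_le_ofReal ?_
      have : 0 < v := by linarith
      rw [div_sub_div _ _ (by positivity) (by positivity), inv_eq_one_div,
        div_le_div_iff₀ (by positivity) (by positivity)]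
      nlinarith)
  simp only [one_mul] at h
  refine h.trans ?_
  rw [← lintegral_const_mul _ hg]
  refine setLIntegral_mono' measurableSet_Icc fun u hu => mul_le_mul_left ?_ _
  refine ENNReal.ofReal_le_of_le_toReal ?_
  simp only [ENNReal.toReal_ofNat]
  exact div_le_self (by norm_num) (by linarith [hu.1])

lemma measurable_weight_term (k : ℕ) : Measurable fun t : ℝ =>
    ENNReal.ofReal ((1 + t)⁻¹) * ENNReal.ofReal (term k t) :=
  Measurable.mul (by fun_prop) (measurable_term k).ennreal_ofReal

/-- Against the Gauss density `1 / (1 + t)`, the operator `f ↦ t * f (gaussMap t)` contracts the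
integral. The majorant `(2/3) / v ^ 2` satisfies the telescoping condition exactly for `v ≥ 1`,
which yields the ratio `2/3` and hence geometric decay of the integrals of the terms. -/
lemma lintegral_weight_term_succ_le (k : ℕ) :
    ∫⁻ t in Set.Icc 0 1, ENNReal.ofReal ((1 + t)⁻¹) * ENNReal.ofReal (term (k + 1) t) ≤
      ENNReal.ofReal (2 / 3) *
        ∫⁻ t in Set.Icc 0 1, ENNReal.ofReal ((1 + t)⁻¹) * ENNReal.ofReal (term k t) := by
  have hm := (measurable_term k).ennreal_ofReal
  have h := lintegral_mul_gaussMap_le (k := fun t => ENNReal.ofReal ((1 + t)⁻¹ * t))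
    hm (D := fun v => (2 / 3) / v ^ 2)
    (by fun_prop) (fun v hv => by positivity)
    (fun v hv => by gcongr; linarith) (fun v hv => by
      rw [← ENNReal.ofReal_mul (by positivity)]
      refine ENNReal.ofReal_le_ofReal ?_
      have : 0 < v := by linarith
      have e : (v ^ 2)⁻¹ * ((1 + v⁻¹)⁻¹ * v⁻¹) = 1 / (v ^ 2 * (v + 1)) := by
        field_simp
      rw [e, div_sub_div _ _ (by positivity) (by positivity),
        div_le_div_iff₀ (by positivity) (by positivity)]
      nlinarith [mul_nonneg (mul_nonneg (sub_nonneg.2 hv) (sq_nonneg v)) (by positivity : 0 ≤ v + 1)])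
  rw [← lintegral_const_mul _ (measurable_weight_term k)]
  calc _ = ∫⁻ t in Set.Icc (0 : ℝ) 1, ENNReal.ofReal ((1 + t)⁻¹ * t) *
        ENNReal.ofReal (term k (gaussMap t)) := by
        refine setLIntegral_congr_fun measurableSet_Icc fun t ht => ?_
        have h1 : 0 ≤ (1 + t)⁻¹ := inv_nonneg.2 (by linarith [ht.1])
        simp only [term_succ]
        rw [ENNReal.ofReal_mul ht.1, ENNReal.ofReal_mul h1, mul_assoc]
    _ ≤ _ := h
    _ ≤ _ := by
        refine setLIntegral_mono' measurableSet_Icc fun u hu => ?_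
        rw [← mul_assoc, ← ENNReal.ofReal_mul (by norm_num : (0 : ℝ) ≤ 2 / 3)]
        refine mul_le_mul_left (ENNReal.ofReal_le_ofReal ?_) _
        have : 1 ≤ 1 + u := by linarith [hu.1]
        rw [div_eq_mul_inv]
        gcongr
        exact le_self_pow₀ this (by norm_num)

lemma lintegral_phi_ne_top : ∫⁻ t in Set.Icc 0 1, phi t ≠ ⊤ := by
  set a : ℕ → ENNReal := fun k =>
    ∫⁻ t in Set.Icc 0 1, ENNReal.ofReal ((1 + t)⁻¹) * ENNReal.ofReal (term k t) with ha
  have ha0 : a 0 ≠ ⊤ := by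
    refine ne_top_of_le_ne_top (b := ∫⁻ t in Set.Icc 0 1, ENNReal.ofReal (Real.log (1 / t))) ?_ ?_
    · rw [lintegral_log_one_div one_pos le_rfl]; exact ENNReal.ofReal_ne_top
    · refine setLIntegral_mono' measurableSet_Icc fun u hu => ?_
      rw [term_zero]
      refine mul_le_of_le_one_left zero_le (ENNReal.ofReal_le_one.2 ?_)
      exact inv_le_one_of_one_le₀ (by linarith [hu.1])
  have hgeo : ∀ k, a k ≤ a 0 * ENNReal.ofReal (2 / 3) ^ k := by
    intro k
    induction k with
    | zero => simp
    | succ k ih =>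
      refine (lintegral_weight_term_succ_le k).trans ?_
      rw [pow_succ']
      calc _ ≤ ENNReal.ofReal (2 / 3) * (a 0 * ENNReal.ofReal (2 / 3) ^ k) := by gcongr
        _ = _ := by ring
  have hsum : ∑' k, a k ≠ ⊤ := by
    refine ne_top_of_le_ne_top ?_ (ENNReal.tsum_le_tsum hgeo)
    rw [ENNReal.tsum_mul_left, ENNReal.tsum_geometric]
    refine ENNReal.mul_ne_top ha0 (ENNReal.inv_ne_top.2 ?_)
    have : ENNReal.ofReal (2 / 3) < 1 := by
      rw [← ENNReal.ofReal_one]; exact ENNReal.ofReal_lt_ofReal_iff_of_nonneg (by norm_num) |>.2 (by norm_num)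
    exact (tsub_pos_of_lt this).ne'
  -- The factor `2` undoes the weight, which is at least `1/2` on `[0,1]`.
  refine ne_top_of_le_ne_top (ENNReal.mul_ne_top ENNReal.ofNat_ne_top hsum :
    2 * ∑' k, a k ≠ ⊤) ?_
  rw [ha, ← lintegral_tsum]
  · rw [← lintegral_const_mul _ (Measurable.tsum measurable_weight_term)]
    refine setLIntegral_mono' measurableSet_Icc fun u hu => ?_
    rw [ENNReal.tsum_mul_left, ← mul_assoc]
    refine le_mul_of_one_le_left zero_le ?_
    have h2 : (2 : ENNReal) = ENNReal.ofReal 2 := by simp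
    rw [h2, ← ENNReal.ofReal_mul (by norm_num), ENNReal.one_le_ofReal, ← div_eq_mul_inv,
      le_div_iff₀ (by linarith [hu.1])]
    linarith [hu.2]
  · intro k
    exact (measurable_weight_term k).aemeasurable

/-- The integral of the Brjuno function over `[0,1]`. -/
def intPhi : ℝ := (∫⁻ t in Set.Icc 0 1, phi t).toReal

lemma intPhi_nonneg : 0 ≤ intPhi := ENNReal.toReal_nonneg

lemma lintegral_phi_eq : ∫⁻ t in Set.Icc 0 1, phi t = ENNReal.ofReal intPhi :=
  (ENNReal.ofReal_toReal lintegral_phi_ne_top).symm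

/-! ### Integrals of `phi` near the endpoints and over periodic translates. -/

lemma lintegral_phi_gaussMap_le {L : ℝ} (hL1 : L ≤ 1) :
    ∫⁻ t in Set.Icc 0 L, ENNReal.ofReal t * phi (gaussMap t) ≤
      ENNReal.ofReal (L * (2 * intPhi)) := by
  rcases lt_or_ge L 0 with h0 | h0
  · simp [Set.Icc_eq_empty_of_lt h0]
  calc _ ≤ ∫⁻ t in Set.Icc 0 L, ENNReal.ofReal L * phi (gaussMap t) := by
        refine setLIntegral_mono' measurableSet_Icc fun u hu => ?_
        gcongr
        exact hu.2
    _ = ENNReal.ofReal L * ∫⁻ t in Set.Icc 0 L, phi (gaussMap t) :=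
        lintegral_const_mul _ (measurable_phi.comp measurable_gaussMap)
    _ ≤ ENNReal.ofReal L * (2 * ∫⁻ t in Set.Icc 0 1, phi t) := by
        gcongr
        exact (lintegral_mono_set (Set.Icc_subset_Icc_right hL1)).trans
          (lintegral_gaussMap_le measurable_phi)
    _ = _ := by
        rw [lintegral_phi_eq, ENNReal.ofReal_mul h0, ENNReal.ofReal_mul (by norm_num)]
        simp

lemma ofReal_log_le_phi {x : ℝ} (hx : 0 ≤ x) : ENNReal.ofReal (Real.log (1 / x)) ≤ phi x := by
  rw [phi_eq hx]; exact le_self_add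

lemma mul_phi_gaussMap_le_phi {x : ℝ} (hx : 0 ≤ x) :
    ENNReal.ofReal x * phi (gaussMap x) ≤ phi x := by
  rw [phi_eq hx]; exact le_add_self

lemma measurable_log_one_div : Measurable fun t : ℝ => ENNReal.ofReal (Real.log (1 / t)) :=
  (Real.measurable_log.comp (measurable_const.div measurable_id)).ennreal_ofReal

lemma lintegral_phi_Icc_eq {s t : ℝ} (hs : 0 ≤ s) :
    ∫⁻ u in Set.Icc s t, phi u = (∫⁻ u in Set.Icc s t, ENNReal.ofReal (Real.log (1 / u))) +
      ∫⁻ u in Set.Icc s t, ENNReal.ofReal u * phi (gaussMap u) := by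
  rw [← lintegral_add_left measurable_log_one_div]
  exact setLIntegral_congr_fun measurableSet_Icc fun u hu => phi_eq (hs.trans hu.1)

lemma log_one_div_nonneg {x : ℝ} (h0 : 0 ≤ x) (h1 : x ≤ 1) : 0 ≤ Real.log (1 / x) := by
  rw [one_div, Real.log_inv]
  linarith [Real.log_nonpos h0 h1]

lemma log_one_div_anti {x y : ℝ} (h0 : 0 < x) (h1 : x ≤ y) :
    Real.log (1 / y) ≤ Real.log (1 / x) := by
  rw [one_div, one_div, Real.log_inv, Real.log_inv]
  linarith [Real.log_le_log h0 h1]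

lemma lintegral_phi_Icc_zero_le {L : ℝ} (h0 : 0 < L) (h1 : L ≤ 1) :
    ∫⁻ u in Set.Icc 0 L, phi u ≤
      ENNReal.ofReal (L * (Real.log (1 / L) + (1 + 2 * intPhi))) := by
  rw [lintegral_phi_Icc_eq le_rfl, lintegral_log_one_div h0 h1]
  refine (add_le_add_right (lintegral_phi_gaussMap_le h1) _).trans ?_
  have h2 := log_one_div_nonneg h0.le h1
  have h3 := intPhi_nonneg
  rw [← ENNReal.ofReal_add (by positivity) (by positivity)]
  exact ENNReal.ofReal_le_ofReal (by linarith)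

/-- The singularity at `1` sits in the second summand of the functional equation: just below `1` the
Gauss map is `t ↦ 1/t - 1`, which maps `[1 - L, 1]` into `[0, 2L]`, so the bound at `0` applies. -/
lemma lintegral_phi_Icc_one_le {L : ℝ} (h0 : 0 < L) (h1 : L ≤ 1 / 4) :
    ∫⁻ u in Set.Icc (1 - L) 1, phi u ≤
      ENNReal.ofReal (L * (2 * (Real.log (1 / L) + (1 + 2 * intPhi)) + 1)) := by
  have h2 := log_one_div_nonneg h0.le (by linarith)
  have h3 := intPhi_nonneg
  have hlog : ∫⁻ u in Set.Icc (1 - L) 1, ENNReal.ofReal (Real.log (1 / u)) ≤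
      ENNReal.ofReal L := by
    calc _ ≤ ∫⁻ u in Set.Icc (1 - L) 1, 1 := by
          refine setLIntegral_mono' measurableSet_Icc fun u hu => ENNReal.ofReal_le_one.2 ?_
          have hu0 : 0 < u := by linarith [hu.1]
          refine (Real.log_le_sub_one_of_pos (by positivity)).trans ?_
          rw [sub_le_iff_le_add, div_le_iff₀ hu0]
          linarith [hu.1]
      _ = _ := by simp
  have hmain : ∫⁻ u in Set.Icc (1 - L) 1, ENNReal.ofReal u * phi (gaussMap u) ≤
      ENNReal.ofReal (L * (2 * (Real.log (1 / L) + (1 + 2 * intPhi)))) := by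
    rw [lintegral_Icc_inv 1 (by linarith) (by linarith)]
    have hend : (1 - L)⁻¹ - 1 ≤ 2 * L := by
      rw [sub_le_iff_le_add, inv_eq_one_div, div_le_iff₀ (by linarith)]
      nlinarith
    calc _ ≤ ∫⁻ u in Set.Icc 0 (2 * L), phi u := by
          refine (lintegral_mono_set (Set.Icc_subset_Icc (by norm_num : (0 : ℝ) ≤ 1⁻¹ - 1) hend)).trans ?_
          refine setLIntegral_mono' measurableSet_Icc fun u hu => ?_
          have hf : Int.fract (1 + u) = u := by
            rw [Int.fract_one_add, Int.fract_eq_self.2 ⟨hu.1, by linarith [hu.2]⟩]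
          rw [gaussMap_inv, hf]
          have h4 : 1 ≤ 1 + u := by linarith [hu.1]
          refine (mul_le_of_le_one_left zero_le (ENNReal.ofReal_le_one.2 ?_)).trans
            (mul_le_of_le_one_left zero_le (ENNReal.ofReal_le_one.2 ?_))
          · exact inv_le_one_of_one_le₀ (one_le_pow₀ h4)
          · exact inv_le_one_of_one_le₀ h4
      _ ≤ _ := lintegral_phi_Icc_zero_le (by linarith) (by linarith)
      _ ≤ _ := by
          refine ENNReal.ofReal_le_ofReal ?_
          have := log_one_div_anti h0 (by linarith : L ≤ 2 * L)
          nlinarith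
  rw [lintegral_phi_Icc_eq (by linarith)]
  refine (add_le_add hlog hmain).trans ?_
  rw [← ENNReal.ofReal_add (by positivity) (by positivity)]
  exact ENNReal.ofReal_le_ofReal (by linarith)

lemma lintegral_Icc_comp_fract {s t : ℝ} (m : ℤ) (hs : 0 ≤ s) (ht : t ≤ 1) (g : ℝ → ENNReal) :
    ∫⁻ v in Set.Icc (m + s) (m + t), g (Int.fract v) = ∫⁻ u in Set.Icc s t, g u := by
  have h := (measurePreserving_add_left volume (m : ℝ)).setLIntegral_comp_emb
    (measurableEmbedding_addLeft (m : ℝ)) (fun v => g (Int.fract v)) (Set.Icc s t)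
  rw [Set.image_const_add_Icc] at h
  rw [← h, setLIntegral_congr Ico_ae_eq_Icc.symm, setLIntegral_congr Ico_ae_eq_Icc.symm]
  refine setLIntegral_congr_fun measurableSet_Ico fun u hu => ?_
  simp only [Int.fract_intCast_add]
  rw [Int.fract_eq_self.2 ⟨hs.trans hu.1, hu.2.trans_le ht⟩]

lemma lintegral_phi_fract_near_int {L : ℝ} (m : ℤ) (h0 : 0 < L) (h1 : L ≤ 1 / 4) :
    ∫⁻ v in Set.Icc (m - L) (m + L), phi (Int.fract v) ≤
      ENNReal.ofReal (L * (3 * (Real.log (1 / L) + (1 + 2 * intPhi)) + 1)) := by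
  have h2 := log_one_div_nonneg h0.le (by linarith)
  have h3 := intPhi_nonneg
  rw [← Set.Icc_union_Icc_eq_Icc (b := (m : ℝ)) (by linarith) (by linarith)]
  refine (lintegral_union_le _ _ _).trans ?_
  have e1 := lintegral_Icc_comp_fract (s := 1 - L) (t := 1) (m - 1) (by linarith) le_rfl phi
  have e2 := lintegral_Icc_comp_fract (s := 0) (t := L) m le_rfl (by linarith) phi
  rw [show ((m - 1 : ℤ) : ℝ) + (1 - L) = m - L by push_cast; ring,
    show ((m - 1 : ℤ) : ℝ) + 1 = m by push_cast; ring] at e1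
  rw [add_zero] at e2
  rw [e1, e2]
  refine (add_le_add (lintegral_phi_Icc_one_le h0 h1)
    (lintegral_phi_Icc_zero_le h0 (by linarith))).trans ?_
  rw [← ENNReal.ofReal_add (by positivity) (by positivity)]
  exact ENNReal.ofReal_le_ofReal (by linarith)

lemma lintegral_phi_fract_le_nat (m : ℤ) (n : ℕ) :
    ∫⁻ v in Set.Icc (m : ℝ) (m + n), phi (Int.fract v) ≤ ENNReal.ofReal (n * intPhi) := by
  have h3 := intPhi_nonneg
  induction n with
  | zero => simp
  | succ n ih =>
    have h0 := n.cast_nonneg (α := ℝ)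
    push_cast
    rw [← add_assoc, ← Set.Icc_union_Icc_eq_Icc (b := (m + n : ℝ)) (by linarith) (by linarith)]
    refine (lintegral_union_le _ _ _).trans ?_
    have e := lintegral_Icc_comp_fract (s := 0) (t := 1) (m + n) le_rfl le_rfl phi
    push_cast at e
    rw [add_zero, lintegral_phi_eq] at e
    rw [e, add_mul, one_mul, ENNReal.ofReal_add (by positivity) h3]
    gcongr

lemma lintegral_phi_fract_le {p q : ℝ} (h : 1 / 4 ≤ q - p) :
    ∫⁻ v in Set.Icc p q, phi (Int.fract v) ≤ ENNReal.ofReal (9 * intPhi * (q - p)) := by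
  have h3 := intPhi_nonneg
  have hp := Int.floor_le p
  have hp' := Int.lt_floor_add_one p
  have hq := Nat.le_ceil (q - ⌊p⌋)
  have hq' := Nat.ceil_lt_add_one (a := q - ⌊p⌋) (by linarith)
  -- Fewer than `(q - p) + 2 ≤ 9 * (q - p)` whole periods cover the interval, because `q - p ≥ 1/4`.
  refine (lintegral_mono_set (Set.Icc_subset_Icc hp (?_ : q ≤ ⌊p⌋ + (⌈q - ⌊p⌋⌉₊ : ℝ)))).trans
    ((lintegral_phi_fract_le_nat _ _).trans (ENNReal.ofReal_le_ofReal ?_))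
  · linarith
  · nlinarith

/-! ### The maximal inequality on intervals that meet a singularity. -/

/-- To the right of `m` the first term of the series suffices. To the left, with `d = m - v`, the
first term is small and the second one is `(1 - d) * log ((1 - d) / d)`; the additive `1` and the
factor `2` absorb the corrections, as `d ≤ 1/4`. -/
lemma log_le_phi_fract {p q v : ℝ} {m : ℤ} (hL : q - p ≤ 1 / 4) (hm : (m : ℝ) ∈ Set.Icc p q)
    (hv : v ∈ Set.Icc p q) (hvm : v ≠ m) :
    ENNReal.ofReal (Real.log (1 / (q - p))) ≤ 2 * (1 + phi (Int.fract v)) := by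
  rcases lt_or_gt_of_ne hvm with h | h
  · set d : ℝ := m - v with hd
    have hd0 : 0 < d := by linarith
    have hdL : d ≤ q - p := by linarith [hm.2, hv.1]
    have hf : Int.fract v = 1 - d := by
      have : v = ((m - 1 : ℤ) : ℝ) + (1 - d) := by push_cast; linarith
      rw [this, Int.fract_intCast_add, Int.fract_eq_self.2 ⟨by linarith, by linarith⟩]
    have hG : gaussMap (1 - d) = d / (1 - d) := by
      have h1 : (1 : ℝ) / (1 - d) = 1 + d / (1 - d) := by
        have : 1 - d ≠ 0 := by linarith
        field_simp; ring
      rw [gaussMap, h1, Int.fract_one_add, Int.fract_eq_self.2]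
      refine ⟨div_nonneg hd0.le (by linarith), ?_⟩
      rw [div_lt_one (by linarith)]; linarith
    have hd1 : 0 < 1 - d := by linarith
    have hb : ENNReal.ofReal ((1 - d) * Real.log (1 / (d / (1 - d)))) ≤ phi (Int.fract v) := by
      rw [hf, ENNReal.ofReal_mul hd1.le]
      refine le_trans ?_ (mul_phi_gaussMap_le_phi hd1.le)
      rw [hG]
      gcongr
      exact ofReal_log_le_phi (by positivity)
    have hl : Real.log (1 / (d / (1 - d))) = Real.log (1 - d) + Real.log (1 / d) := by
      rw [← Real.log_mul hd1.ne' (by positivity)]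
      congr 1; field_simp
    have hl1 : -(1 / 3) ≤ Real.log (1 - d) := by
      have := Real.one_sub_inv_le_log_of_pos hd1
      have h2 : (1 - d)⁻¹ ≤ 4 / 3 := by
        rw [inv_le_comm₀ hd1 (by norm_num)]; norm_num; linarith
      linarith
    have hl2 := log_one_div_anti hd0 hdL
    have hl3 := log_one_div_nonneg (by linarith : 0 ≤ q - p) (by linarith)
    have hl4 : 0 ≤ Real.log (1 / (d / (1 - d))) := by
      refine log_one_div_nonneg (by positivity) ?_
      rw [div_le_one hd1]; linarith
    calc _ ≤ ENNReal.ofReal (2 * (1 + (1 - d) * Real.log (1 / (d / (1 - d))))) := by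
          refine ENNReal.ofReal_le_ofReal ?_
          rw [hl] at *
          nlinarith
      _ = 2 * (1 + ENNReal.ofReal ((1 - d) * Real.log (1 / (d / (1 - d))))) := by
          rw [ENNReal.ofReal_mul (by norm_num), ENNReal.ofReal_add (by norm_num) (by positivity)]
          simp
      _ ≤ _ := by gcongr
  · have hf : Int.fract v = v - m := by
      have : v = m + (v - m) := by ring
      rw [this, Int.fract_intCast_add, Int.fract_eq_self.2 ⟨by linarith, by linarith [hv.2, hm.1]⟩]
      ring
    rw [hf]
    calc _ ≤ ENNReal.ofReal (Real.log (1 / (v - m))) :=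
          ENNReal.ofReal_le_ofReal (log_one_div_anti (by linarith) (by linarith [hv.2, hm.1]))
      _ ≤ phi (v - m) := ofReal_log_le_phi (by linarith)
      _ ≤ 1 + phi (v - m) := le_add_self
      _ ≤ _ := le_mul_of_one_le_left zero_le (by norm_num)

/-- On a short interval of length `L` around an integer the mean is `O(1 + log (1 / L))`, and every
non-integer point of it already has a `phi` value comparable with `log (1 / L)`. On a long interval
the mean is bounded by periodicity. -/
lemma lintegral_phi_fract_le_of_int_mem {p q v : ℝ} {m : ℤ} (hpq : p < q)
    (hm : (m : ℝ) ∈ Set.Icc p q) (hv : v ∈ Set.Icc p q) (hvi : Irrational v) :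
    ∫⁻ y in Set.Icc p q, phi (Int.fract y) ≤
      ENNReal.ofReal ((10 + 9 * intPhi) * (q - p)) * (1 + phi (Int.fract v)) := by
  have h3 := intPhi_nonneg
  have hL0 : 0 < q - p := by linarith
  rcases le_or_gt (1 / 4) (q - p) with h | h
  · refine (lintegral_phi_fract_le h).trans ?_
    refine (ENNReal.ofReal_le_ofReal ?_).trans (le_mul_of_one_le_right zero_le le_self_add)
    nlinarith
  · have hl := log_one_div_nonneg hL0.le (by linarith)
    refine (lintegral_mono_set (Set.Icc_subset_Icc (?_ : (m : ℝ) - (q - p) ≤ p)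
      (?_ : q ≤ m + (q - p)))).trans
      ((lintegral_phi_fract_near_int m hL0 h.le).trans ?_)
    · linarith [hm.2]
    · linarith [hm.1]
    calc _ = ENNReal.ofReal (3 * (q - p)) * ENNReal.ofReal (Real.log (1 / (q - p))) +
          ENNReal.ofReal ((4 + 6 * intPhi) * (q - p)) := by
          rw [← ENNReal.ofReal_mul (by positivity),
            ← ENNReal.ofReal_add (by positivity) (by positivity)]
          congr 1; ring
      _ ≤ ENNReal.ofReal (3 * (q - p)) * (2 * (1 + phi (Int.fract v))) +
          ENNReal.ofReal ((4 + 6 * intPhi) * (q - p)) * (1 + phi (Int.fract v)) := by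
          gcongr
          · exact log_le_phi_fract h.le hm hv (hvi.ne_int m)
          · exact le_mul_of_one_le_right zero_le le_self_add
      _ = ENNReal.ofReal ((10 + 6 * intPhi) * (q - p)) * (1 + phi (Int.fract v)) := by
          rw [← mul_assoc, ← add_mul]
          congr 1
          have h2 : (2 : ENNReal) = ENNReal.ofReal 2 := by simp
          rw [h2, ← ENNReal.ofReal_mul (by positivity),
            ← ENNReal.ofReal_add (by positivity) (by positivity)]
          congr 1; ring
      _ ≤ _ := by
          gcongr
          linarith

lemma log_one_div_le_add_one {x u : ℝ} (hx : 0 < x) (hu : x / 2 ≤ u) :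
    Real.log (1 / u) ≤ Real.log (1 / x) + 1 := by
  have h1 := log_one_div_anti (by linarith : 0 < x / 2) hu
  have h2 : Real.log (1 / (x / 2)) = Real.log (1 / x) + Real.log 2 := by
    rw [← Real.log_mul (by positivity) (by norm_num)]
    congr 1; field_simp
  linarith [Real.log_two_lt_d9]

lemma lintegral_log_Icc_le {s t x : ℝ} (hs : 0 ≤ s) (hsx : s ≤ x) (hxt : x ≤ t) (ht : t ≤ 1)
    (hx : 0 < x) : ∫⁻ u in Set.Icc s t, ENNReal.ofReal (Real.log (1 / u)) ≤
      ENNReal.ofReal ((2 + 2 * Real.log (1 / x)) * (t - s)) := by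
  have hl := log_one_div_nonneg hx.le (hxt.trans ht)
  rcases le_or_gt (t / 2) s with h | h
  · calc _ ≤ ∫⁻ u in Set.Icc s t, ENNReal.ofReal (Real.log (1 / x) + 1) := by
          refine setLIntegral_mono' measurableSet_Icc fun u hu => ENNReal.ofReal_le_ofReal ?_
          exact log_one_div_le_add_one hx (by linarith [hu.1])
      _ = ENNReal.ofReal ((Real.log (1 / x) + 1) * (t - s)) := by
          rw [setLIntegral_const, Real.volume_Icc, ← ENNReal.ofReal_mul (by positivity)]
      _ ≤ _ := ENNReal.ofReal_le_ofReal (by nlinarith)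
  · refine (lintegral_mono_set (Set.Icc_subset_Icc_left hs)).trans ?_
    rw [lintegral_log_one_div (hx.trans_le hxt) ht]
    refine ENNReal.ofReal_le_ofReal ?_
    have := log_one_div_anti hx hxt
    have := log_one_div_nonneg (hx.le.trans hxt) ht
    nlinarith

lemma gaussMap_eq_fract_inv (x : ℝ) : gaussMap x = Int.fract x⁻¹ := by
  rw [gaussMap, one_div]

lemma lintegral_mul_phi_gaussMap_le_of_int {s t x : ℝ} {m : ℤ} (hs : t / 2 ≤ s) (hst : s < t)
    (ht : t ≤ 1) (hsx : s ≤ x) (hxt : x ≤ t) (hx : Irrational x)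
    (hm : (m : ℝ) ∈ Set.Icc t⁻¹ s⁻¹) :
    ∫⁻ u in Set.Icc s t, ENNReal.ofReal u * phi (gaussMap u) ≤
      ENNReal.ofReal ((40 + 36 * intPhi) * (t - s)) * (1 + phi x) := by
  have h3 := intPhi_nonneg
  have ht0 : 0 < t := by linarith
  have hs0 : 0 < s := by linarith
  have hx0 : 0 < x := by linarith
  have hlt : t⁻¹ < s⁻¹ := inv_strictAnti₀ hs0 hst
  rw [lintegral_Icc_inv 0 hs0 hst.le]
  simp only [sub_zero, zero_add]
  calc _ ≤ ∫⁻ v in Set.Icc t⁻¹ s⁻¹, ENNReal.ofReal (t ^ 3) * phi (Int.fract v) := by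
        refine setLIntegral_mono' measurableSet_Icc fun v hv => ?_
        have hv0 : 0 < v := (inv_pos.2 ht0).trans_le hv.1
        rw [gaussMap_inv, ← mul_assoc, ← ENNReal.ofReal_mul (by positivity)]
        gcongr
        have : v⁻¹ ≤ t := by rw [inv_le_comm₀ hv0 ht0]; exact hv.1
        calc (v ^ 2)⁻¹ * v⁻¹ = v⁻¹ ^ 3 := by rw [← inv_pow]; ring
          _ ≤ t ^ 3 := by gcongr
    _ = ENNReal.ofReal (t ^ 3) * ∫⁻ v in Set.Icc t⁻¹ s⁻¹, phi (Int.fract v) :=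
        lintegral_const_mul _ (measurable_phi.comp measurable_fract)
    _ ≤ ENNReal.ofReal (t ^ 3) * (ENNReal.ofReal ((10 + 9 * intPhi) * (s⁻¹ - t⁻¹)) *
          (1 + phi (Int.fract x⁻¹))) := by
        gcongr
        exact lintegral_phi_fract_le_of_int_mem hlt hm
          ⟨inv_anti₀ hx0 hxt, inv_anti₀ hs0 hsx⟩ hx.inv
    _ ≤ ENNReal.ofReal ((40 + 36 * intPhi) * (t - s) * x) * (1 + phi (gaussMap x)) := by
        rw [← mul_assoc, ← ENNReal.ofReal_mul (by positivity), gaussMap_eq_fract_inv]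
        refine mul_le_mul_left (ENNReal.ofReal_le_ofReal ?_) _
        have e : t ^ 3 * ((10 + 9 * intPhi) * (s⁻¹ - t⁻¹)) =
            (10 + 9 * intPhi) * (t - s) * (t ^ 2 / s) := by
          field_simp
        -- Uses `t ≤ 2 * s` and `t ≤ 2 * x`. The factor `x` gained here turns `phi (gaussMap x)`
        -- into `x * phi (gaussMap x) ≤ phi x`.
        have h5 : t ^ 2 / s ≤ 4 * x := by
          rw [div_le_iff₀ hs0]; nlinarith
        rw [e]
        calc _ ≤ (10 + 9 * intPhi) * (t - s) * (4 * x) := by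
              have : 0 ≤ t - s := by linarith
              gcongr
          _ = _ := by ring
    _ ≤ _ := by
        have : 0 ≤ t - s := by linarith
        rw [ENNReal.ofReal_mul (by positivity), mul_assoc, mul_add, mul_one]
        gcongr
        · exact ENNReal.ofReal_le_one.2 (by linarith)
        · exact mul_phi_gaussMap_le_phi hx0.le

/-- If `s < t / 2`, then `t < 2 * (t - s)` and integrals over `[0, t]` suffice; otherwise the
inverted interval contains an integer. -/
lemma lintegral_phi_le_base {s t x : ℝ} (hs : 0 ≤ s) (hst : s < t)
    (ht : t ≤ 1) (hsx : s ≤ x) (hxt : x ≤ t) (hx : Irrational x)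
    (h : s < t / 2 ∨ ∃ m : ℤ, (m : ℝ) ∈ Set.Icc t⁻¹ s⁻¹) :
    ∫⁻ u in Set.Icc s t, phi u ≤
      ENNReal.ofReal ((42 + 36 * intPhi) * (t - s)) * (1 + phi x) := by
  have h3 := intPhi_nonneg
  have hx0 : 0 < x := (hs.trans hsx).lt_of_ne hx.ne_zero.symm
  have hl := log_one_div_nonneg hx0.le (hxt.trans ht)
  have hts : 0 ≤ t - s := by linarith
  have hmain : ∫⁻ u in Set.Icc s t, ENNReal.ofReal u * phi (gaussMap u) ≤
      ENNReal.ofReal ((40 + 36 * intPhi) * (t - s)) * (1 + phi x) := by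
    rcases lt_or_ge s (t / 2) with h' | h'
    · refine (lintegral_mono_set (Set.Icc_subset_Icc_left hs)).trans
        ((lintegral_phi_gaussMap_le ht).trans ?_)
      refine (ENNReal.ofReal_le_ofReal ?_).trans (le_mul_of_one_le_right zero_le le_self_add)
      nlinarith
    · obtain ⟨m, hm⟩ := h.resolve_left (not_lt.2 h')
      exact lintegral_mul_phi_gaussMap_le_of_int h' hst ht hsx hxt hx hm
  have hlog : ∫⁻ u in Set.Icc s t, ENNReal.ofReal (Real.log (1 / u)) ≤
      ENNReal.ofReal (2 * (t - s)) * (1 + phi x) := by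
    refine (lintegral_log_Icc_le hs hsx hxt ht hx0).trans ?_
    rw [show (2 + 2 * Real.log (1 / x)) * (t - s) = 2 * (t - s) * (1 + Real.log (1 / x)) by ring,
      ENNReal.ofReal_mul (by positivity), ENNReal.ofReal_add zero_le_one hl, ENNReal.ofReal_one]
    gcongr
    exact ofReal_log_le_phi hx0.le
  rw [lintegral_phi_Icc_eq hs]
  refine (add_le_add hlog hmain).trans ?_
  rw [← add_mul, ← ENNReal.ofReal_add (by positivity) (by positivity)]
  gcongr
  linarith

/-! ### The maximal inequality by descent along the Gauss map. -/

/-- The constant of the maximal inequality for the Brjuno function. -/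
def maxConst : ℝ := 8 * (42 + 36 * intPhi)

lemma le_maxConst : 8 ≤ maxConst := by
  have := intPhi_nonneg
  rw [maxConst]; linarith

/-- Since `b ≤ a`, the weight `a + b * y` varies by a factor of at most `2` on `[0,1]`, so its cube
by at most `8`. The mixed form on the right is chosen because, times `t - s`, it transforms exactly
under the Gauss map. -/
lemma inv_cube_le {a b u s t x : ℝ} (ha : 0 < a) (hb : 0 ≤ b) (hba : b ≤ a) (hu : 0 ≤ u)
    (hs : s ∈ Set.Icc (0 : ℝ) 1) (ht : t ∈ Set.Icc (0 : ℝ) 1) (hx : x ∈ Set.Icc (0 : ℝ) 1) :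
    ((a + b * u) ^ 3)⁻¹ ≤ 8 * ((a + b * x)⁻¹ * ((a + b * s) * (a + b * t))⁻¹) := by
  have key : ∀ y ∈ Set.Icc (0 : ℝ) 1, 0 < a + b * y ∧ a + b * y ≤ 2 * a := fun y hy =>
    ⟨by nlinarith [hy.1], by nlinarith [hy.1, hy.2]⟩
  obtain ⟨hx1, hx2⟩ := key x hx
  obtain ⟨hs1, hs2⟩ := key s hs
  obtain ⟨ht1, ht2⟩ := key t ht
  rw [← mul_inv]
  calc ((a + b * u) ^ 3)⁻¹ ≤ (a ^ 3)⁻¹ := by gcongr; nlinarith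
    _ = 8 * ((2 * a) * ((2 * a) * (2 * a)))⁻¹ := by field_simp; norm_num
    _ ≤ _ := by gcongr

/-- The maximal inequality for the Brjuno function, with weights that are stable under the
Gauss map. The fraction `p / q` serves for an induction on the denominator `q`. -/
lemma lintegral_weight_phi_le (q : ℕ) : ∀ (p : ℕ) (a b s t x : ℝ), 0 < q → 0 < a → 0 ≤ b → b ≤ a →
    0 ≤ s → s < t → t ≤ 1 → s ≤ x → x ≤ t → Irrational x → s * q ≤ p → p ≤ t * q →
    ∫⁻ u in Set.Icc s t, ENNReal.ofReal (((a + b * u) ^ 3)⁻¹) * phi u ≤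
      ENNReal.ofReal (maxConst * ((a + b * x)⁻¹ * ((a + b * s) * (a + b * t))⁻¹ * (t - s))) *
        (phi x + ENNReal.ofReal (2 + x)) := by
  -- A Gauss step sends `p / q` to `(q - m * p) / p`, and `p < q` in the inductive case because `p /
  -- q ≤ t < 1`. Lowest terms are not needed.
  induction q using Nat.strong_induction_on with
  | _ q ih =>
  intro p a b s t x hq ha hb hba hs hst ht hsx hxt hx hsq hqt
  have h3 := intPhi_nonneg
  have hC := le_maxConst
  have hts : 0 ≤ t - s := by linarith
  have hx0 : 0 < x := (hs.trans hsx).lt_of_ne hx.ne_zero.symm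
  have hcube : ∀ u, 0 ≤ u →
      ((a + b * u) ^ 3)⁻¹ ≤ 8 * ((a + b * x)⁻¹ * ((a + b * s) * (a + b * t))⁻¹) := fun u hu =>
    inv_cube_le ha hb hba hu ⟨hs, by linarith⟩ ⟨by linarith, ht⟩ ⟨hx0.le, by linarith⟩
  have hM0 : 0 ≤ (a + b * x)⁻¹ * ((a + b * s) * (a + b * t))⁻¹ := by
    have := hcube 0 le_rfl
    have : 0 ≤ ((a + b * 0) ^ 3)⁻¹ := by rw [mul_zero, add_zero]; positivity
    linarith
  by_cases hbase : s < t / 2 ∨ ∃ m : ℤ, (m : ℝ) ∈ Set.Icc t⁻¹ s⁻¹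
  · calc _ ≤ ∫⁻ u in Set.Icc s t, ENNReal.ofReal
          (8 * ((a + b * x)⁻¹ * ((a + b * s) * (a + b * t))⁻¹)) * phi u := by
          refine setLIntegral_mono' measurableSet_Icc fun u hu => ?_
          gcongr
          exact hcube u (hs.trans hu.1)
      _ = ENNReal.ofReal (8 * ((a + b * x)⁻¹ * ((a + b * s) * (a + b * t))⁻¹)) *
          ∫⁻ u in Set.Icc s t, phi u := lintegral_const_mul _ measurable_phi
      _ ≤ ENNReal.ofReal (8 * ((a + b * x)⁻¹ * ((a + b * s) * (a + b * t))⁻¹)) *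
          (ENNReal.ofReal ((42 + 36 * intPhi) * (t - s)) * (1 + phi x)) := by
          gcongr
          exact lintegral_phi_le_base hs hst ht hsx hxt hx hbase
      _ ≤ _ := by
          rw [← mul_assoc, ← ENNReal.ofReal_mul (by positivity), add_comm (1 : ENNReal)]
          refine mul_le_mul' (ENNReal.ofReal_le_ofReal (le_of_eq ?_))
            (add_le_add le_rfl (ENNReal.one_le_ofReal.2 (by linarith)))
          rw [maxConst]; ring
  · push Not at hbase
    obtain ⟨hs2, hint⟩ := hbase
    have ht0 : 0 < t := by linarith
    have hs0 : 0 < s := by linarith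
    have h1t : 1 ≤ t⁻¹ := (one_le_inv₀ ht0).2 ht
    obtain ⟨m, hm⟩ : ∃ m : ℕ, m = ⌊t⁻¹⌋₊ := ⟨_, rfl⟩
    have hm1 : 1 ≤ m := hm ▸ (Nat.one_le_floor_iff _).2 h1t
    have hm1' : (1 : ℝ) ≤ m := by exact_mod_cast hm1
    have hmle : (m : ℝ) ≤ t⁻¹ := hm ▸ Nat.floor_le (by linarith)
    have hmlt : t⁻¹ < m + 1 := hm ▸ Nat.lt_floor_add_one _
    have hlt : t⁻¹ < s⁻¹ := inv_strictAnti₀ hs0 hst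
    have hm2 : (m : ℝ) < t⁻¹ := hmle.lt_of_ne fun h =>
      hint m ⟨by push_cast; exact h.ge, by push_cast; linarith⟩
    have hm3 : s⁻¹ < m + 1 := by
      by_contra hcon
      exact hint (m + 1) ⟨by push_cast; exact hmlt.le, by push_cast; linarith⟩
    have hxt' : t⁻¹ ≤ x⁻¹ := inv_anti₀ hx0 hxt
    have hsx' : x⁻¹ ≤ s⁻¹ := inv_anti₀ hs0 hsx
    have hG : gaussMap x = x⁻¹ - m := by
      rw [gaussMap_eq_fract_inv]
      have : x⁻¹ = m + (x⁻¹ - m) := by ring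
      rw [this, Int.fract_natCast_add, Int.fract_eq_self.2 ⟨by linarith, by linarith⟩]
      ring
    have hq0 : (0 : ℝ) < q := by exact_mod_cast hq
    have hp0 : (0 : ℝ) < p := (mul_pos hs0 hq0).trans_le hsq
    have ht1 : t < 1 := by
      rw [← inv_inv t]; exact inv_lt_one_of_one_lt₀ (by linarith)
    have hpq : p < q := by
      have : (p : ℝ) < q := by nlinarith
      exact_mod_cast this
    have hmp : m * p ≤ q := by
      have h1 : (m : ℝ) * p ≤ q := by
        calc (m : ℝ) * p ≤ t⁻¹ * (t * q) := by gcongr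
          _ = q := by field_simp
      exact_mod_cast h1
    -- The new weight comes from `a + b / (m + y) = (a * m + b + a * y) / (m + y)`; `m ≥ 1` keeps
    -- its coefficients ordered.
    have hIH := ih p hpq (q - m * p) (a * m + b) a (t⁻¹ - m) (s⁻¹ - m) (gaussMap x)
      (by exact_mod_cast hp0) (by positivity) ha.le (by nlinarith) (by linarith) (by linarith)
      (by linarith) (by rw [hG]; linarith) (by rw [hG]; linarith) (irrational_gaussMap hx)
      (by
        rw [Nat.cast_sub hmp]; push_cast
        have : t⁻¹ * p ≤ q := by rw [inv_mul_le_iff₀ ht0]; exact hqt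
        linarith)
      (by
        rw [Nat.cast_sub hmp]; push_cast
        have : q ≤ s⁻¹ * p := by rw [le_inv_mul_iff₀ hs0]; exact hsq
        linarith)
    -- The cube fits exactly: two powers of `m + y` come from the Jacobian and one from the factor
    -- `u`.
    have hmain : ∫⁻ u in Set.Icc s t, ENNReal.ofReal (((a + b * u) ^ 3)⁻¹) *
        (ENNReal.ofReal u * phi (gaussMap u)) =
        ∫⁻ y in Set.Icc (t⁻¹ - m) (s⁻¹ - m),
          ENNReal.ofReal (((a * m + b + a * y) ^ 3)⁻¹) * phi y := by
      rw [lintegral_Icc_inv m hs0 hst.le]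
      refine setLIntegral_congr_fun measurableSet_Icc fun y hy => ?_
      have hy0 : 0 < y := by linarith [hy.1]
      have hf : Int.fract ((m : ℝ) + y) = y := by
        rw [Int.fract_natCast_add, Int.fract_eq_self.2 ⟨hy0.le, by linarith [hy.2]⟩]
      have hmy : 0 < (m : ℝ) + y := by linarith
      simp only [gaussMap_inv, hf]
      rw [← mul_assoc, ← mul_assoc, ← ENNReal.ofReal_mul (by positivity),
        ← ENNReal.ofReal_mul (by positivity)]
      congr 2
      have h1 : 0 < a + b * (m + y)⁻¹ := by positivity
      have h2 : a * m + b + a * y = (a + b * (m + y)⁻¹) * (m + y) := by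
        field_simp; ring
      rw [h2]
      field_simp
    have hMx : (a * m + b + a * gaussMap x)⁻¹ * ((a * m + b + a * (t⁻¹ - m)) *
        (a * m + b + a * (s⁻¹ - m)))⁻¹ * (s⁻¹ - m - (t⁻¹ - m)) =
        ((a + b * x)⁻¹ * ((a + b * s) * (a + b * t))⁻¹ * (t - s)) * x := by
      have hA : 0 < a + b * x := by positivity
      have hB : 0 < a + b * s := by positivity
      have hD : 0 < a + b * t := by positivity
      have e1 : a * m + b + a * gaussMap x = (a + b * x) / x := by rw [hG]; field_simp; ring
      have e2 : a * m + b + a * (t⁻¹ - m) = (a + b * t) / t := by field_simp; ring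
      have e3 : a * m + b + a * (s⁻¹ - m) = (a + b * s) / s := by field_simp; ring
      have e4 : s⁻¹ - m - (t⁻¹ - m) = (t - s) / (s * t) := by field_simp; ring
      rw [e1, e2, e3, e4]
      field_simp
    set M := (a + b * x)⁻¹ * ((a + b * s) * (a + b * t))⁻¹ with hMdef
    have hl := log_one_div_nonneg hx0.le (hxt.trans ht)
    have hlog : ∫⁻ u in Set.Icc s t, ENNReal.ofReal (((a + b * u) ^ 3)⁻¹) *
        ENNReal.ofReal (Real.log (1 / u)) ≤
        ENNReal.ofReal (maxConst * (M * (t - s))) * (ENNReal.ofReal (Real.log (1 / x)) + 1) := by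
      calc _ ≤ ∫⁻ u in Set.Icc s t, ENNReal.ofReal (8 * M * (Real.log (1 / x) + 1)) := by
            refine setLIntegral_mono' measurableSet_Icc fun u hu => ?_
            have hu0 : 0 < u := hs0.trans_le hu.1
            rw [← ENNReal.ofReal_mul (by positivity)]
            refine ENNReal.ofReal_le_ofReal ?_
            exact mul_le_mul (hcube u hu0.le) (log_one_div_le_add_one hx0 (by linarith [hu.1]))
              (log_one_div_nonneg hu0.le (hu.2.trans ht)) (by positivity)
        _ = ENNReal.ofReal (8 * (M * (t - s)) * (Real.log (1 / x) + 1)) := by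
            rw [setLIntegral_const, Real.volume_Icc, ← ENNReal.ofReal_mul (by positivity)]
            congr 1; ring
        _ ≤ _ := by
            rw [ENNReal.ofReal_mul (by positivity), ENNReal.ofReal_add hl zero_le_one,
              ENNReal.ofReal_one]
            gcongr
    have hsplit : ∫⁻ u in Set.Icc s t, ENNReal.ofReal (((a + b * u) ^ 3)⁻¹) * phi u =
        (∫⁻ u in Set.Icc s t, ENNReal.ofReal (((a + b * u) ^ 3)⁻¹) *
          ENNReal.ofReal (Real.log (1 / u))) +
        ∫⁻ u in Set.Icc s t, ENNReal.ofReal (((a + b * u) ^ 3)⁻¹) *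
          (ENNReal.ofReal u * phi (gaussMap u)) := by
      have hmeas : Measurable fun u : ℝ => ENNReal.ofReal (((a + b * u) ^ 3)⁻¹) *
          ENNReal.ofReal (Real.log (1 / u)) := Measurable.mul (by fun_prop) measurable_log_one_div
      rw [← lintegral_add_left hmeas]
      refine setLIntegral_congr_fun measurableSet_Icc fun u hu => ?_
      rw [phi_eq (hs.trans hu.1), mul_add]
    rw [hMx] at hIH
    rw [hsplit, hmain]
    refine (add_le_add hlog hIH).trans ?_
    have hG0 := gaussMap_nonneg x
    -- This is why the error term is `2 + x`: since `m ≥ 1`, pulling it back leaves `1 + x`, with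
    -- room for the `1` lost in comparing `log (1 / u)` with `log (1 / x)`.
    have hxG : x * (2 + gaussMap x) ≤ 1 + x := by
      rw [hG]
      have : x * (2 + (x⁻¹ - m)) = 1 + 2 * x - m * x := by field_simp; ring
      rw [this]; nlinarith
    rw [← mul_assoc maxConst _ x, ENNReal.ofReal_mul (q := x) (by positivity),
      mul_assoc (ENNReal.ofReal _) (ENNReal.ofReal x), ← mul_add]
    refine mul_le_mul' le_rfl ?_
    rw [phi_eq hx0.le, mul_add, ← ENNReal.ofReal_mul hx0.le]
    calc _ = ENNReal.ofReal (Real.log (1 / x)) + ENNReal.ofReal x * phi (gaussMap x) +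
          (ENNReal.ofReal 1 + ENNReal.ofReal (x * (2 + gaussMap x))) := by
          rw [ENNReal.ofReal_one]; ring
      _ ≤ _ := by
          rw [← ENNReal.ofReal_add zero_le_one (by positivity)]
          exact add_le_add le_rfl (ENNReal.ofReal_le_ofReal (by linarith))

/-- The maximal inequality for the Brjuno function. -/
lemma lintegral_phi_le {s t x : ℝ} (hs : 0 ≤ s) (hst : s ≤ t) (ht : t ≤ 1) (hsx : s ≤ x)
    (hxt : x ≤ t) (hx : Irrational x) :
    ∫⁻ u in Set.Icc s t, phi u ≤
      ENNReal.ofReal (maxConst * (t - s)) * (phi x + ENNReal.ofReal (2 + x)) := by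
  rcases hst.eq_or_lt with rfl | hst
  · simp
  obtain ⟨r, hr1, hr2⟩ := exists_rat_btwn hst
  have hr0 : 0 ≤ r := by
    have : (0 : ℝ) < r := hs.trans_lt hr1
    exact_mod_cast this.le
  have hnum : ((r.num.toNat : ℕ) : ℝ) = r * r.den := by
    have h1 : ((r.num.toNat : ℕ) : ℤ) = r.num := Int.toNat_of_nonneg (Rat.num_nonneg.2 hr0)
    have h2 : (r : ℝ) * r.den = r.num := by exact_mod_cast Rat.mul_den_eq_num r
    rw [h2]; exact_mod_cast congrArg (Int.cast : ℤ → ℝ) h1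
  -- The choice `a = 1`, `b = 0` makes the weight constant; any rational inside the interval starts
  -- the descent.
  have h := lintegral_weight_phi_le r.den r.num.toNat 1 0 s t x r.den_pos one_pos le_rfl
    zero_le_one hs hst ht hsx hxt hx (by rw [hnum]; gcongr) (by rw [hnum]; gcongr)
  simpa using h

/-! ### Local means at Brjuno numbers. -/

/-- The means of the Brjuno function over small intervals containing `x` are at most `A`. -/
def LocalMeanLE (x A : ℝ) : Prop :=
  ∀ᶠ p : ℝ × ℝ in 𝓝 (x, x), p.1 ≤ x → x ≤ p.2 →
    ∫⁻ u in Set.Icc p.1 p.2, phi u ≤ ENNReal.ofReal (A * (p.2 - p.1))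

lemma LocalMeanLE.mono {x A B : ℝ} (h : LocalMeanLE x A) (hAB : A ≤ B) : LocalMeanLE x B := by
  filter_upwards [h] with p hp h1 h2
  exact (hp h1 h2).trans (ENNReal.ofReal_le_ofReal (by nlinarith))

/-- In contrast to the maximal inequality, no constant is lost: the factor `t ^ 2 / s` tends to `x`
when both endpoints do. -/
lemma lintegral_mul_phi_gaussMap_le {s t A : ℝ} {m : ℤ} (hs : 0 < s) (hst : s ≤ t)
    (hmt : (m : ℝ) ≤ t⁻¹) (hms : s⁻¹ < m + 1)
    (h : ∫⁻ u in Set.Icc (t⁻¹ - m) (s⁻¹ - m), phi u ≤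
      ENNReal.ofReal (A * (s⁻¹ - m - (t⁻¹ - m)))) :
    ∫⁻ u in Set.Icc s t, ENNReal.ofReal u * phi (gaussMap u) ≤
      ENNReal.ofReal (t ^ 2 / s * A * (t - s)) := by
  have ht : 0 < t := hs.trans_le hst
  rw [lintegral_Icc_inv m hs hst]
  calc _ ≤ ∫⁻ y in Set.Icc (t⁻¹ - m) (s⁻¹ - m), ENNReal.ofReal (t ^ 3) * phi y := by
        refine setLIntegral_mono' measurableSet_Icc fun y hy => ?_
        have ht' : 0 < t⁻¹ := inv_pos.2 ht
        have hy' : t⁻¹ ≤ m + y := by linarith [hy.1]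
        have hmy : 0 < (m : ℝ) + y := ht'.trans_le hy'
        have hf : Int.fract ((m : ℝ) + y) = y := by
          rw [Int.fract_intCast_add, Int.fract_eq_self.2 ⟨by linarith [hy.1], by linarith [hy.2]⟩]
        rw [gaussMap_inv, hf, ← mul_assoc, ← ENNReal.ofReal_mul (by positivity)]
        gcongr
        have : ((m : ℝ) + y)⁻¹ ≤ t := by rwa [inv_le_comm₀ hmy ht]
        calc (((m : ℝ) + y) ^ 2)⁻¹ * ((m : ℝ) + y)⁻¹ = ((m : ℝ) + y)⁻¹ ^ 3 := by
              rw [← inv_pow]; ring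
          _ ≤ t ^ 3 := by gcongr
    _ = ENNReal.ofReal (t ^ 3) * ∫⁻ y in Set.Icc (t⁻¹ - m) (s⁻¹ - m), phi y :=
        lintegral_const_mul _ measurable_phi
    _ ≤ ENNReal.ofReal (t ^ 3) * ENNReal.ofReal (A * (s⁻¹ - m - (t⁻¹ - m))) := by gcongr
    _ = _ := by
        rw [← ENNReal.ofReal_mul (by positivity)]
        congr 1
        field_simp
        ring

lemma LocalMeanLE.of_gaussMap {x A B : ℝ} (hx : Irrational x) (hx01 : x ∈ Set.Ioo (0 : ℝ) 1)
    (hA : 0 ≤ A) (h : LocalMeanLE (gaussMap x) A) (hB : Real.log (1 / x) + x * A < B) :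
    LocalMeanLE x B := by
  have hx0 := hx01.1
  set m : ℤ := ⌊x⁻¹⌋ with hm
  have hG : gaussMap x = x⁻¹ - m := by rw [gaussMap_eq_fract_inv, Int.fract]
  have hG0 := gaussMap_mem_Ioo hx
  rw [hG] at hG0
  have c1 : Tendsto (fun p : ℝ × ℝ => p.1) (𝓝 (x, x)) (𝓝 x) := continuousAt_fst
  have c2 : Tendsto (fun p : ℝ × ℝ => p.2) (𝓝 (x, x)) (𝓝 x) := continuousAt_snd
  have i1 : Tendsto (fun p : ℝ × ℝ => p.1⁻¹) (𝓝 (x, x)) (𝓝 x⁻¹) := c1.inv₀ hx0.ne'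
  have i2 : Tendsto (fun p : ℝ × ℝ => p.2⁻¹) (𝓝 (x, x)) (𝓝 x⁻¹) := c2.inv₀ hx0.ne'
  have hJ : Tendsto (fun p : ℝ × ℝ => (p.2⁻¹ - m, p.1⁻¹ - m)) (𝓝 (x, x))
      (𝓝 (gaussMap x, gaussMap x)) := by
    rw [hG]
    exact (i2.sub_const _).prodMk_nhds (i1.sub_const _)
  have hlim : Tendsto (fun p : ℝ × ℝ => Real.log (1 / p.1) + p.2 ^ 2 / p.1 * A) (𝓝 (x, x))
      (𝓝 (Real.log (1 / x) + x ^ 2 / x * A)) := by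
    refine Tendsto.add ?_ (((c2.pow 2).div c1 hx0.ne').mul_const A)
    simp only [one_div]
    exact i1.log (inv_ne_zero hx0.ne')
  have hxx : x ^ 2 / x = x := by field_simp
  rw [hxx] at hlim
  filter_upwards [hJ.eventually h, hlim.eventually_lt_const hB, c1.eventually_const_lt hx0,
    c2.eventually_lt_const hx01.2, i2.eventually_const_lt (by linarith [hG0.1] : (m : ℝ) < x⁻¹),
    i1.eventually_lt_const (by linarith [hG0.2] : x⁻¹ < m + 1)]
    with p hp hlt hs ht hmt hms hsx hxt
  obtain ⟨s, t⟩ := p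
  simp only at *
  have hst : s ≤ t := hsx.trans hxt
  have hts : 0 ≤ t - s := by linarith
  have hmain := lintegral_mul_phi_gaussMap_le hs hst hmt.le hms
    (hp (by rw [hG]; linarith [inv_anti₀ hx0 hxt]) (by rw [hG]; linarith [inv_anti₀ hs hsx]))
  have hlog : ∫⁻ u in Set.Icc s t, ENNReal.ofReal (Real.log (1 / u)) ≤
      ENNReal.ofReal (Real.log (1 / s) * (t - s)) := by
    rw [ENNReal.ofReal_mul (log_one_div_nonneg hs.le (by linarith)), ← Real.volume_Icc,
      ← setLIntegral_const]
    exact setLIntegral_mono' measurableSet_Icc fun u hu =>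
      ENNReal.ofReal_le_ofReal (log_one_div_anti hs hu.1)
  have hl := log_one_div_nonneg hs.le (by linarith)
  have ht0 : 0 < t := by linarith
  rw [lintegral_phi_Icc_eq hs.le]
  refine (add_le_add hlog hmain).trans ?_
  rw [← ENNReal.ofReal_add (by positivity) (by positivity)]
  exact ENNReal.ofReal_le_ofReal (by nlinarith)

lemma LocalMeanLE.of_alpha (n : ℕ) {x A B : ℝ} (hx : Irrational x)
    (hx01 : x ∈ Set.Ioo (0 : ℝ) 1) (hA : 0 ≤ A) (h : LocalMeanLE (alpha n x) A)
    (hB : ∑ k ∈ Finset.range n, term k x + (∏ j ∈ Finset.range n, alpha j x) * A < B) :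
    LocalMeanLE x B := by
  induction n generalizing x B with
  | zero => exact h.mono (by simpa using hB.le)
  | succ n ih =>
    have hG01 := gaussMap_mem_Ioo hx
    set E := ∑ k ∈ Finset.range n, term k (gaussMap x) +
      (∏ j ∈ Finset.range n, alpha j (gaussMap x)) * A with hE
    have hE0 : 0 ≤ E :=
      add_nonneg (Finset.sum_nonneg fun k _ => term_nonneg ⟨hG01.1.le, hG01.2.le⟩ k)
        (mul_nonneg (Finset.prod_nonneg fun j _ =>
          (alpha_mem_Icc ⟨hG01.1.le, hG01.2.le⟩ j).1) hA)
    have hB' : Real.log (1 / x) + x * E < B := by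
      refine lt_of_eq_of_lt ?_ hB
      rw [Finset.sum_range_succ', prod_alpha_succ, term_zero]
      simp only [term_succ]
      rw [← Finset.mul_sum, hE]
      ring
    rw [alpha_succ] at h
    -- Each pullback needs strict room; half of the gap is spent at `gaussMap x` and half at `x`.
    set η := (B - (Real.log (1 / x) + x * E)) / 2 with hη
    have hη0 : 0 < η := by linarith
    refine LocalMeanLE.of_gaussMap hx hx01 (by linarith)
      (ih (B := E + η) (irrational_gaussMap hx) hG01 h (by linarith)) ?_
    have : x * η ≤ 1 * η := by gcongr; exact hx01.2.le
    rw [mul_add]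
    linarith

lemma term_add (n k : ℕ) (x : ℝ) :
    term (k + n) x = (∏ j ∈ Finset.range n, alpha j x) * term k (alpha n x) := by
  induction n generalizing x with
  | zero => simp [alpha_zero]
  | succ n ih => rw [← add_assoc, term_succ, ih, prod_alpha_succ, alpha_succ, mul_assoc]

lemma mul_two_add_gaussMap_le {x : ℝ} (h : x ∈ Set.Ioo (0 : ℝ) 1) :
    x * (2 + gaussMap x) ≤ 1 + x := by
  have h1 : (1 : ℝ) ≤ ⌊x⁻¹⌋ := by
    exact_mod_cast Int.le_floor.2 (by exact_mod_cast (one_lt_inv₀ h.1).2 h.2 |>.le)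
  rw [gaussMap_eq_fract_inv, Int.fract]
  have h2 := h.1
  have : x * (2 + (x⁻¹ - ⌊x⁻¹⌋)) = 1 + 2 * x - ⌊x⁻¹⌋ * x := by field_simp; ring
  rw [this]
  nlinarith

lemma prod_alpha_nonneg {x : ℝ} (h : x ∈ Set.Ioo (0 : ℝ) 1) (n : ℕ) :
    0 ≤ ∏ j ∈ Finset.range n, alpha j x :=
  Finset.prod_nonneg fun j _ => (alpha_mem_Icc ⟨h.1.le, h.2.le⟩ j).1

/-- Iterating `x * (2 + gaussMap x) ≤ 1 + x` telescopes. The resulting bound on the sum of the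
products forces them to tend to `0`. -/
lemma sum_prod_alpha_le {x : ℝ} (hx : Irrational x) (h : x ∈ Set.Ioo (0 : ℝ) 1) (n : ℕ) :
    ∑ k ∈ Finset.range n, ∏ j ∈ Finset.range k, alpha j x +
      (∏ j ∈ Finset.range n, alpha j x) * (2 + alpha n x) ≤ 2 + x := by
  induction n with
  | zero => simp [alpha_zero]
  | succ n ih =>
    rw [Finset.sum_range_succ, Finset.prod_range_succ, alpha_succ']
    have := mul_le_mul_of_nonneg_left (mul_two_add_gaussMap_le (alpha_mem_Ioo hx h n))
      (prod_alpha_nonneg h n)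
    linarith

lemma tendsto_prod_alpha {x : ℝ} (hx : Irrational x) (h : x ∈ Set.Ioo (0 : ℝ) 1) :
    Tendsto (fun n => ∏ j ∈ Finset.range n, alpha j x) atTop (𝓝 0) := by
  refine (summable_of_sum_range_le (c := 2 + x) (prod_alpha_nonneg h) fun n => ?_).tendsto_atTop_zero
  have h1 := sum_prod_alpha_le hx h n
  have h2 := mul_nonneg (prod_alpha_nonneg h n)
    (by linarith [(alpha_mem_Ioo hx h n).1] : 0 ≤ 2 + alpha n x)
  linarith

lemma phi_eq_ofReal_tsum {x : ℝ} (h : x ∈ Set.Ioo (0 : ℝ) 1) (hs : Summable fun k => term k x) :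
    phi x = ENNReal.ofReal (∑' k, term k x) :=
  (ENNReal.ofReal_tsum_of_nonneg (fun k => term_nonneg ⟨h.1.le, h.2.le⟩ k) hs).symm

lemma localMeanLE_max {x T : ℝ} (hx : Irrational x) (h : x ∈ Set.Ioo (0 : ℝ) 1) (hT : 0 ≤ T)
    (hphi : phi x = ENNReal.ofReal T) : LocalMeanLE x (maxConst * (T + (2 + x))) := by
  have hC := le_maxConst
  have hx0 := h.1
  filter_upwards [(continuousAt_fst (p := (x, x))).tendsto.eventually_const_lt h.1,
    (continuousAt_snd (p := (x, x))).tendsto.eventually_lt_const h.2] with p h1 h2 h3 h4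
  refine (lintegral_phi_le h1.le (h3.trans h4) h2.le h3 h4 hx).trans (le_of_eq ?_)
  have : 0 ≤ p.2 - p.1 := by linarith
  rw [hphi, ← ENNReal.ofReal_add hT (by linarith), ← ENNReal.ofReal_mul (by positivity)]
  congr 1
  ring

/-- The maximal inequality at `alpha n x`, pulled back `n` times, gives the `n`-th partial sum plus
`β n * maxConst * (T n + 3)`. Here `β n * T n` is the tail of the series, so the whole bound tends
to its sum. -/
lemma localMeanLE_of_summable {x B : ℝ} (hx : Irrational x) (h : x ∈ Set.Ioo (0 : ℝ) 1)
    (hs : Summable fun k => term k x) (hB : ∑' k, term k x < B) : LocalMeanLE x B := by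
  have hC := le_maxConst
  set β : ℕ → ℝ := fun n => ∏ j ∈ Finset.range n, alpha j x with hβ
  have hβpos : ∀ n, 0 < β n := fun n => Finset.prod_pos fun j _ => (alpha_mem_Ioo hx h j).1
  have hsn : ∀ n, Summable fun k => term k (alpha n x) := fun n => by
    have h1 := (summable_nat_add_iff n).2 hs
    simp only [term_add] at h1
    exact (summable_mul_left_iff (hβpos n).ne').1 h1
  set T : ℕ → ℝ := fun n => ∑' k, term k (alpha n x) with hTdef
  have hT0 : ∀ n, 0 ≤ T n := fun n => tsum_nonneg fun k =>
    term_nonneg ⟨(alpha_mem_Ioo hx h n).1.le, (alpha_mem_Ioo hx h n).2.le⟩ k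
  have hβT : ∀ n, β n * T n = ∑' k, term (k + n) x := fun n => by
    simp only [term_add, hTdef]
    rw [tsum_mul_left]
  have hβ0 : Tendsto β atTop (𝓝 0) := tendsto_prod_alpha hx h
  have hlim : Tendsto (fun n => ∑ k ∈ Finset.range n, term k x +
      β n * (maxConst * (T n + 3))) atTop (𝓝 (∑' k, term k x)) := by
    have h1 := hs.hasSum.tendsto_sum_nat
    have h2 : Tendsto (fun n => β n * T n) atTop (𝓝 0) := by
      simp only [hβT]
      exact tendsto_sum_nat_add fun k => term k x
    have h3 := h1.add ((h2.const_mul maxConst).add (hβ0.const_mul (maxConst * 3)))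
    simp only [mul_zero, add_zero] at h3
    refine h3.congr fun n => ?_
    ring
  obtain ⟨n, hn⟩ := (hlim.eventually_lt_const hB).exists
  have hαn := alpha_mem_Ioo hx h n
  have hmax := localMeanLE_max (irrational_alpha hx n) hαn (hT0 n) (phi_eq_ofReal_tsum hαn (hsn n))
  refine LocalMeanLE.of_alpha n hx h (A := maxConst * (T n + 3)) ?_ (hmax.mono ?_) hn
  · have := hT0 n
    positivity
  · gcongr
    linarith [hαn.2]

/-! ### Lower semicontinuity at irrationals and divergence off the Brjuno numbers. -/

lemma continuousAt_fract_of_irrational {x : ℝ} (hx : Irrational x) :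
    ContinuousAt (Int.fract : ℝ → ℝ) x :=
  continuousAt_fract (hx.ne_int _)

lemma continuousAt_gaussMap {x : ℝ} (hx : Irrational x) : ContinuousAt gaussMap x := by
  have h : ContinuousAt (fun y : ℝ => 1 / y) x := continuousAt_const.div continuousAt_id hx.ne_zero
  refine ContinuousAt.comp (g := Int.fract) (f := fun y : ℝ => 1 / y) ?_ h
  rw [one_div]
  exact continuousAt_fract_of_irrational hx.inv

lemma continuousAt_alpha {x : ℝ} (hx : Irrational x) (k : ℕ) : ContinuousAt (alpha k) x := by
  induction k with
  | zero => exact continuousAt_id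
  | succ k ih =>
    have h : alpha (k + 1) = gaussMap ∘ alpha k := funext fun y => alpha_succ' k y
    rw [h]
    exact (continuousAt_gaussMap (irrational_alpha hx k)).comp ih

lemma continuousAt_term {x : ℝ} (hx : Irrational x) (k : ℕ) : ContinuousAt (term k) x := by
  have h := (irrational_alpha hx k).ne_zero
  have h1 : ContinuousAt (fun y => ∏ j ∈ Finset.range k, alpha j y) x :=
    tendsto_finsetProd _ fun j _ => continuousAt_alpha hx j
  exact h1.mul ((continuousAt_const.div (continuousAt_alpha hx k) h).log
    (one_div_ne_zero h))

lemma lowerSemicontinuousAt_phi {x : ℝ} (hx : Irrational x) : LowerSemicontinuousAt phi x :=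
  lowerSemicontinuousAt_tsum fun k =>
    (ENNReal.continuous_ofReal.continuousAt.comp (continuousAt_term hx k)).lowerSemicontinuousAt

lemma tendsto_phi_fract_int (m : ℤ) :
    Tendsto (fun v : ℝ => phi (Int.fract v)) (𝓝[≠] (m : ℝ)) (𝓝 ⊤) := by
  have hdist : Tendsto (fun v : ℝ => |v - m|) (𝓝[≠] (m : ℝ)) (𝓝[>] 0) := by
    refine tendsto_nhdsWithin_iff.2 ⟨?_, ?_⟩
    · have : Tendsto (fun v : ℝ => |v - m|) (𝓝 (m : ℝ)) (𝓝 |(m : ℝ) - m|) :=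
        (continuous_id.sub continuous_const).abs.continuousAt
      rw [sub_self, abs_zero] at this
      exact this.mono_left nhdsWithin_le_nhds
    · filter_upwards [self_mem_nhdsWithin] with v hv
      exact abs_pos.2 (sub_ne_zero.2 hv)
  have hlog : Tendsto (fun v : ℝ => ENNReal.ofReal (Real.log (1 / |v - m|))) (𝓝[≠] (m : ℝ))
      (𝓝 ⊤) := by
    refine ENNReal.tendsto_ofReal_atTop.comp ?_
    simp only [one_div]
    exact Real.tendsto_log_atTop.comp (tendsto_inv_nhdsGT_zero.comp hdist)
  have hle : ∀ᶠ v : ℝ in 𝓝[≠] (m : ℝ),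
      ENNReal.ofReal (Real.log (1 / |v - m|)) ≤ 2 * (1 + phi (Int.fract v)) := by
    filter_upwards [self_mem_nhdsWithin, (hdist.mono_right nhdsWithin_le_nhds).eventually_le_const
      (by norm_num : (0 : ℝ) < 1 / 4)] with v hv hv4
    have e := max_sub_min_eq_abs' v (m : ℝ)
    rw [← e] at hv4 ⊢
    exact log_le_phi_fract hv4 ⟨min_le_right _ _, le_max_right _ _⟩
      ⟨min_le_left _ _, le_max_left _ _⟩ hv
  have htop := tendsto_nhds_top_mono hlog hle
  rw [ENNReal.tendsto_nhds_top_iff_nnreal] at htop ⊢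
  intro M
  filter_upwards [htop (2 * (1 + M))] with v hv
  push_cast at hv
  by_contra hcon
  exact hv.not_ge (by gcongr; exact not_lt.1 hcon)

/-- Near `r` the coefficient in `t * phi (gaussMap t) ≤ phi t` is at least `r / 2`, so divergence at
`r⁻¹` passes to `r`. Neighbourhoods are punctured because `phi` is finite at rationals. -/
lemma tendsto_phi_of_inv {r : ℝ} (hr : 0 < r)
    (h : Tendsto (fun v : ℝ => phi (Int.fract v)) (𝓝[≠] r⁻¹) (𝓝 ⊤)) :
    Tendsto phi (𝓝[≠] r) (𝓝 ⊤) := by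
  have hinv : Tendsto (fun t : ℝ => t⁻¹) (𝓝[≠] r) (𝓝[≠] r⁻¹) := by
    refine tendsto_nhdsWithin_iff.2
      ⟨(continuousAt_inv₀ hr.ne').tendsto.mono_left nhdsWithin_le_nhds, ?_⟩
    filter_upwards [self_mem_nhdsWithin] with t ht
    exact fun h => ht (inv_injective h)
  have h1 := ENNReal.Tendsto.const_mul (a := ENNReal.ofReal (r / 2)) (h.comp hinv)
    (Or.inl ENNReal.top_ne_zero)
  rw [ENNReal.mul_top (by simpa using hr)] at h1
  refine tendsto_nhds_top_mono h1 ?_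
  filter_upwards [nhdsWithin_le_nhds (lt_mem_nhds (half_lt_self hr))] with t ht
  refine le_trans ?_ (mul_phi_gaussMap_le_phi (by linarith))
  rw [gaussMap_eq_fract_inv]
  exact mul_le_mul' (ENNReal.ofReal_le_ofReal ht.le) le_rfl

lemma tendsto_phi_fract_of_fract {x : ℝ} (hx : x ≠ ⌊x⌋)
    (h : Tendsto phi (𝓝[≠] (Int.fract x)) (𝓝 ⊤)) :
    Tendsto (fun v : ℝ => phi (Int.fract v)) (𝓝[≠] x) (𝓝 ⊤) := by
  refine h.comp (tendsto_nhdsWithin_iff.2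
    ⟨(continuousAt_fract hx).tendsto.mono_left nhdsWithin_le_nhds, ?_⟩)
  have hmem : ∀ᶠ v in 𝓝 x, v ∈ Set.Ioo (⌊x⌋ : ℝ) (⌊x⌋ + 1) :=
    Ioo_mem_nhds ((Int.floor_le x).lt_of_ne hx.symm) (Int.lt_floor_add_one x)
  filter_upwards [self_mem_nhdsWithin, nhdsWithin_le_nhds hmem] with v hv hv2 heq
  have hfl : ⌊v⌋ = ⌊x⌋ := Int.floor_eq_iff.2 ⟨hv2.1.le, hv2.2⟩
  simp only [Set.mem_singleton_iff, Int.fract, hfl] at heq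
  exact hv (sub_left_injective heq)

/-- A Euclidean descent: a non-integral `p / q` has fractional part `n / q` with `0 < n < q`, and
its inverse `q / n` has the smaller denominator `n`. -/
lemma tendsto_phi_fract_rat (q : ℕ) : ∀ p : ℤ, 0 < q →
    Tendsto (fun v : ℝ => phi (Int.fract v)) (𝓝[≠] ((p : ℝ) / q)) (𝓝 ⊤) := by
  induction q using Nat.strong_induction_on with
  | _ q ih =>
  intro p hq
  have hq0 : (0 : ℝ) < q := by exact_mod_cast hq
  by_cases hint : (p : ℝ) / q = ⌊(p : ℝ) / q⌋
  · rw [hint]; exact tendsto_phi_fract_int _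
  · refine tendsto_phi_fract_of_fract hint ?_
    set n : ℤ := p - ⌊(p : ℝ) / q⌋ * q with hn
    have hfr : Int.fract ((p : ℝ) / q) = (n : ℝ) / q := by
      rw [Int.fract, hn]; push_cast; field_simp
    have hf0 : 0 < Int.fract ((p : ℝ) / q) := Int.fract_pos.2 hint
    have hf1 := Int.fract_lt_one ((p : ℝ) / q)
    rw [hfr] at hf0 hf1 ⊢
    have hn0 : (0 : ℝ) < n := by
      rcases div_pos_iff.1 hf0 with h | h
      · exact h.1
      · linarith
    have hn1 : (n : ℝ) < q := (div_lt_one hq0).1 hf1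
    obtain ⟨k, hk⟩ := Int.eq_ofNat_of_zero_le (by exact_mod_cast hn0.le : 0 ≤ n)
    have h := ih k (by rw [hk] at hn1; exact_mod_cast hn1) q
      (by rw [hk] at hn0; exact_mod_cast hn0)
    refine tendsto_phi_of_inv hf0 ?_
    rw [inv_div, hk]
    exact_mod_cast h

lemma tendsto_phi_of_not_irrational {x : ℝ} (hx0 : 0 < x) (hx : ¬ Irrational x) :
    Tendsto phi (𝓝[≠] x) (𝓝 ⊤) := by
  obtain ⟨r, rfl⟩ := not_not.1 hx
  refine tendsto_phi_of_inv hx0 ?_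
  have h := tendsto_phi_fract_rat r⁻¹.den r⁻¹.num r⁻¹.den_pos
  have e : ((r : ℝ))⁻¹ = (r⁻¹.num : ℝ) / (r⁻¹.den : ℝ) := by
    rw [← Rat.cast_inv, Rat.cast_def r⁻¹]
  rw [e]
  exact h

lemma phi_eq_top {x : ℝ} (h : x ∈ Set.Ioo (0 : ℝ) 1) (hs : ¬ Summable fun k => term k x) :
    phi x = ⊤ := by
  by_contra hne
  have h1 := ENNReal.summable_toReal hne
  refine hs (h1.congr fun k => ?_)
  rw [ENNReal.toReal_ofReal (term_nonneg ⟨h.1.le, h.2.le⟩ k)]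

/-- The Brjuno function tends to infinity at every point that is not a Brjuno number. -/
lemma tendsto_phi_of_notMem_brjunoNumbers {x : ℝ} (h : x ∈ Set.Ioo (0 : ℝ) 1)
    (hx : x ∉ brjunoNumbers) : Tendsto phi (𝓝[≠] x) (𝓝 ⊤) := by
  by_cases hi : Irrational x
  · have htop := phi_eq_top h fun hs => hx ⟨h, hi, hs⟩
    rw [ENNReal.tendsto_nhds_top_iff_nnreal]
    intro M
    refine nhdsWithin_le_nhds (lowerSemicontinuousAt_phi hi M ?_)
    change (M : ENNReal) < phi x
    rw [htop]
    exact ENNReal.coe_lt_top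
  · exact tendsto_phi_of_not_irrational h.1 hi

/-! ### From local behaviour to Lebesgue points. -/

lemma one_le_abs_coe_sub {p : ENNReal} {c : ℝ} (h : ENNReal.ofReal (|c| + 1) ≤ p) :
    1 ≤ ((p : EReal) - (c : EReal)).abs := by
  induction p with
  | top => simp
  | coe r =>
    have h1 : |c| + 1 ≤ r := by
      have := ENNReal.toReal_mono ENNReal.coe_ne_top h
      rwa [ENNReal.toReal_ofReal (by positivity), ENNReal.coe_toReal] at this
    rw [EReal.coe_nnreal_eq_coe_real, ← EReal.coe_sub, EReal.abs_def,
      ENNReal.one_le_ofReal]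
    have := le_abs_self c
    have := le_abs_self (r - c : ℝ)
    linarith

/-- This is `|p - c| ≤ p - c + 2ε`, arranged without subtraction in `ENNReal`; it makes a one-sided
bound on the means sufficient. -/
lemma abs_coe_sub_add_le {p : ENNReal} {c ε : ℝ} (hc : 0 ≤ c) (hε : 0 ≤ ε)
    (h : ENNReal.ofReal (c - ε) ≤ p) :
    ((p : EReal) - (c : EReal)).abs + ENNReal.ofReal c ≤ p + ENNReal.ofReal (2 * ε) := by
  induction p with
  | top => simp
  | coe r =>
    have h1 : c - ε ≤ r := ENNReal.ofReal_le_coe.1 h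
    rw [EReal.coe_nnreal_eq_coe_real, ← EReal.coe_sub, EReal.abs_def,
      ← ENNReal.ofReal_add (abs_nonneg _) hc, ← ENNReal.ofReal_coe_nnreal,
      ← ENNReal.ofReal_add r.coe_nonneg (by positivity)]
    refine ENNReal.ofReal_le_ofReal ?_
    rcases abs_cases (r - c : ℝ) with ⟨h2, -⟩ | ⟨h2, -⟩ <;> rw [h2] <;> linarith

lemma not_tendsto_meanDeviation {x : ℝ} {c : EReal}
    (h : ∀ᶠ t in 𝓝[≠] x, 1 ≤ (Phi t - c).abs) :
    ¬ Tendsto (meanDeviation Phi c x) (𝓝[>] 0) (𝓝 0) := by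
  intro hlim
  obtain ⟨δ, hδ, hball⟩ := Metric.mem_nhdsWithin_iff.1 h
  have hsmall := hlim.eventually_lt_const (zero_lt_one)
  obtain ⟨y, hy1, hy2, hy3⟩ := (hsmall.and ((eventually_mem_nhdsWithin).and
    (nhdsWithin_le_nhds (gt_mem_nhds hδ)))).exists
  have hy0 : 0 < y := hy2
  refine hy1.not_ge ?_
  rw [meanDeviation, ENNReal.le_div_iff_mul_le (Or.inl (by simpa using hy0))
    (Or.inl ENNReal.ofReal_ne_top), one_mul]
  calc ENNReal.ofReal y = ∫⁻ t in Set.Icc (x - y / 2) (x + y / 2), 1 := by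
        simp only [lintegral_const, one_mul, Measure.restrict_apply MeasurableSet.univ,
          Set.univ_inter, Real.volume_Icc]
        congr 1; ring
    _ ≤ _ := by
        refine lintegral_mono_ae ?_
        have hne : ∀ᵐ t ∂(volume.restrict (Set.Icc (x - y / 2) (x + y / 2))), t ≠ x :=
          ae_restrict_of_ae (Measure.ae_ne volume x)
        filter_upwards [hne, ae_restrict_mem measurableSet_Icc] with t ht1 ht2
        refine hball ⟨?_, ht1⟩
        rw [Metric.mem_ball, Real.dist_eq, abs_lt]
        have : y < δ := hy3
        constructor <;> linarith [ht2.1, ht2.2]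

lemma not_isLOneLebesguePoint {x : ℝ} (h : x ∈ Set.Ioo (0 : ℝ) 1) (hx : x ∉ brjunoNumbers) :
    ¬ IsLOneLebesguePoint Phi x := by
  rintro ⟨c, hc⟩
  refine not_tendsto_meanDeviation ?_ hc
  filter_upwards [(tendsto_phi_of_notMem_brjunoNumbers h hx).eventually_const_le
    (ENNReal.ofReal_lt_top (r := |c| + 1))] with t ht
  exact one_le_abs_coe_sub ht

lemma isLOneLebesguePoint_of_isLebesguePoint {x : ℝ} (h : IsLebesguePoint Phi x) :
    IsLOneLebesguePoint Phi x := by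
  rcases eq_or_ne (phi x) ⊤ with htop | htop
  -- With `Phi x = ⊤` the deviation is infinite at every `t`, even where `Phi t = ⊤`, because `⊤ - ⊤
  -- = ⊥` in `EReal`.
  · refine absurd h (not_tendsto_meanDeviation (Eventually.of_forall fun t => ?_))
    rw [Phi_eq x, htop]
    simp
  · refine ⟨(phi x).toReal, ?_⟩
    have e : (((phi x).toReal : ℝ) : EReal) = Phi x := EReal.coe_ennreal_toReal htop
    rw [e]
    exact h

lemma tendsto_meanDeviation_of_mem {x : ℝ} (hx : x ∈ brjunoNumbers) :
    Tendsto (meanDeviation Phi ((∑' k, term k x : ℝ) : EReal) x) (𝓝[>] 0) (𝓝 0) := by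
  obtain ⟨h, hi, hs⟩ := hx
  set c := ∑' k, term k x with hc
  have hc0 : 0 ≤ c := tsum_nonneg fun k => term_nonneg ⟨h.1.le, h.2.le⟩ k
  have key : ∀ ε > 0, ∀ᶠ y in 𝓝[>] (0 : ℝ), meanDeviation Phi (c : EReal) x y ≤
      ENNReal.ofReal (3 * ε) := by
    intro ε hε
    have hlow : ∀ᶠ t in 𝓝 x, ENNReal.ofReal (c - ε) ≤ phi t := by
      rcases le_or_gt c ε with hcε | hcε
      · refine Eventually.of_forall fun t => ?_
        rw [ENNReal.ofReal_of_nonpos (by linarith)]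
        exact zero_le
      · refine (lowerSemicontinuousAt_phi hi (ENNReal.ofReal (c - ε)) ?_).mono fun t ht => ht.le
        change ENNReal.ofReal (c - ε) < phi x
        rw [phi_eq_ofReal_tsum h hs]
        exact (ENNReal.ofReal_lt_ofReal_iff (by linarith)).2 (by linarith)
    obtain ⟨δ, hδ, hball⟩ := Metric.eventually_nhds_iff.1 hlow
    have hup := localMeanLE_of_summable hi h hs (B := c + ε) (by linarith)
    have hint : Tendsto (fun y : ℝ => (x - y / 2, x + y / 2)) (𝓝[>] 0) (𝓝 (x, x)) := by
      have : ContinuousAt (fun y : ℝ => (x - y / 2, x + y / 2)) 0 := by fun_prop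
      have h2 := this.tendsto
      simp only [zero_div, sub_zero, add_zero] at h2
      exact h2.mono_left nhdsWithin_le_nhds
    filter_upwards [hint.eventually hup, self_mem_nhdsWithin,
      nhdsWithin_le_nhds (gt_mem_nhds hδ)] with y hy1 hy2 hy3
    have hy0 : 0 < y := hy2
    have hyδ : y < δ := hy3
    have hy4 := hy1 (by linarith) (by linarith)
    rw [show x + y / 2 - (x - y / 2) = y by ring] at hy4
    have hvol : volume (Set.Icc (x - y / 2) (x + y / 2)) = ENNReal.ofReal y := by
      rw [Real.volume_Icc]; congr 1; ring
    rw [meanDeviation]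
    refine ENNReal.div_le_of_le_mul ?_
    -- The finite quantity `c * y` is added to both sides. The total `3 * ε` is `ε` from the upper
    -- bound on the mean and `2 * ε` from the pointwise lower bound.
    refine ENNReal.le_of_add_le_add_right (a := ENNReal.ofReal c * ENNReal.ofReal y)
      (ENNReal.mul_ne_top ENNReal.ofReal_ne_top ENNReal.ofReal_ne_top) ?_
    calc _ = ∫⁻ t in Set.Icc (x - y / 2) (x + y / 2),
          ((Phi t - (c : EReal)).abs + ENNReal.ofReal c) := by
          rw [lintegral_add_right _ measurable_const, setLIntegral_const, hvol]
      _ ≤ ∫⁻ t in Set.Icc (x - y / 2) (x + y / 2), (phi t + ENNReal.ofReal (2 * ε)) := by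
          refine setLIntegral_mono' measurableSet_Icc fun t ht => ?_
          refine abs_coe_sub_add_le hc0 hε.le (hball ?_)
          rw [Real.dist_eq, abs_lt]
          constructor <;> linarith [ht.1, ht.2]
      _ = (∫⁻ t in Set.Icc (x - y / 2) (x + y / 2), phi t) +
          ENNReal.ofReal (2 * ε) * ENNReal.ofReal y := by
          rw [lintegral_add_right _ measurable_const, setLIntegral_const, hvol]
      _ ≤ ENNReal.ofReal ((c + ε) * y) + ENNReal.ofReal (2 * ε) * ENNReal.ofReal y := by
          gcongr
      _ = _ := by
          rw [← ENNReal.ofReal_mul (by positivity), ← ENNReal.ofReal_mul (by positivity),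
            ← ENNReal.ofReal_mul (by positivity),
            ← ENNReal.ofReal_add (by positivity) (by positivity),
            ← ENNReal.ofReal_add (by positivity) (by positivity)]
          congr 1; ring
  rw [ENNReal.tendsto_nhds_zero]
  intro ε hε
  obtain ⟨r, hr0, hr⟩ := ENNReal.lt_iff_exists_real_btwn.1 hε
  have hr1 : 0 < r := ENNReal.ofReal_pos.1 hr.1
  filter_upwards [key (r / 3) (by positivity)] with y hy
  rw [mul_div_cancel₀ _ (by norm_num)] at hy
  exact hy.trans hr.2.le

lemma isLebesguePoint_of_mem {x : ℝ} (hx : x ∈ brjunoNumbers) : IsLebesguePoint Phi x := by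
  have h := tendsto_meanDeviation_of_mem hx
  obtain ⟨h01, -, hs⟩ := hx
  have e : Phi x = ((∑' k, term k x : ℝ) : EReal) := by
    rw [Phi_eq, phi_eq_ofReal_tsum h01 hs, EReal.coe_ennreal_ofReal, max_eq_left]
    exact tsum_nonneg fun k => term_nonneg ⟨h01.1.le, h01.2.le⟩ k
  rw [IsLebesguePoint, e]
  exact h

end

end Brjuno

theorem mainTheorem1 :
    {x : ℝ | x ∈ Set.Ioo (0 : ℝ) 1 ∧ Brjuno.IsLebesguePoint Brjuno.Phi x} = Brjuno.brjunoNumbers ∧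
    {x : ℝ | x ∈ Set.Ioo (0 : ℝ) 1 ∧ Brjuno.IsLOneLebesguePoint Brjuno.Phi x} =
      Brjuno.brjunoNumbers := by
  refine ⟨Set.ext fun x => ⟨fun h => ?_, fun h => ⟨h.1, Brjuno.isLebesguePoint_of_mem h⟩⟩,
    Set.ext fun x => ⟨fun h => ?_, fun h =>
      ⟨h.1, Brjuno.isLOneLebesguePoint_of_isLebesguePoint (Brjuno.isLebesguePoint_of_mem h)⟩⟩⟩
  · by_contra hx
    exact Brjuno.not_isLOneLebesguePoint h.1 hx
      (Brjuno.isLOneLebesguePoint_of_isLebesguePoint h.2)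
  · by_contra hx
    exact Brjuno.not_isLOneLebesguePoint h.1 hx h.2
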